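/- Let $p$ be a prime and let $G$ be a free pro-$p$ group of finite rank $r>1$. Then $G$ is $\mathrm{Aut}_1$ but not $\mathrm{Aut}_2$, and the commensurator $\mathrm{Comm}(G)$, endowed with the $\mathrm{Aut}$-topology, is not locally compact. Here the following definitions are used. * For a profinite group $U$, $\mathrm{Aut}(U)$ is the group of continuous automorphisms of $U$ with its standard topology: the subgroups $A(O)=\{\gamma : g^{-1}\gamma(g)\in O \text{ for all } g\in U\}$, with $O$ an open subgroup of $U$, form a base of neighbourhoods of the identity. $\mathrm{TAut}(U)\le\mathrm{Aut}(U)$ is the subgroup of automorphisms that fix pointwise some open subgroup of $U$. * $\mathrm{Comm}(G)$ is the group of topological isomorphisms between open subgroups of $G$, two of them being identified when they coincide on some open subgroup; the product is induced by composition (where defined). For an open subgroup $U$ of $G$, let $\rho_U\colon\mathrm{Aut}(U)\to\mathrm{Comm}(G)$ be the canonical homomorphism, and let $\underline{\mathrm{Aut}}(U)$ be its image with the quotient topology from $\mathrm{Aut}(U)$. * The $\mathrm{Aut}$-topology on $\mathrm{Comm}(G)$ is the unique group topology for which the subgroups $H\le\mathrm{Comm}(G)$ such that $\rho_O^{-1}(H)$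 is open in $\mathrm{Aut}(O)$ for every open subgroup $O$ of $G$ form a base of neighbourhoods of the identity. * $G$ is $\mathrm{Aut}_1$ if $\mathrm{TAut}(U)$ is closed in $\mathrm{Aut}(U)$ for every open subgroup $U$ of $G$. * For open subgroups $V\subseteq U$ of $G$, let $\underline{\mathrm{Aut}}(U)_V\subseteq\underline{\mathrm{Aut}}(V)$ be the image in $\mathrm{Comm}(G)$ of $\{\alpha\in\mathrm{Aut}(U):\alpha(V)=V\}$. The subgroup $U$ is $\mathrm{Aut}$-stable if $\underline{\mathrm{Aut}}(U)_V$ is open in $\underline{\mathrm{Aut}}(V)$ for every open subgroup $V$ of $U$. $G$ is $\mathrm{Aut}_2$ if it is $\mathrm{Aut}_1$ and some open subgroup of $G$ is $\mathrm{Aut}$-stable. -/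

import Mathlib

namespace AutTop

universe u

section Topologies

/-- The topology on a group `X` attached to a family `F` of subgroups which is downward directed:
a set is open iff, with each of its points `x`, it contains a coset `x A` with `A ∈ F`.
The members of `F` form a base of neighbourhoods of `1`, consisting of open subgroups. -/
@[reducible] def subgroupFamilyTopology {X : Type*} [Group X] (F : Set (Subgroup X))
    (hne : F.Nonempty) (hdir : ∀ A ∈ F, ∀ B ∈ F, ∃ C ∈ F, C ≤ A ⊓ B) : TopologicalSpace X where
  IsOpen S := ∀ x ∈ S, ∃ A ∈ F, ∀ a ∈ A, x * a ∈ S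
  isOpen_univ := fun _ _ => by
    obtain ⟨A, hA⟩ := hne
    exact ⟨A, hA, fun _ _ => Set.mem_univ _⟩
  isOpen_inter := fun S T hS hT x hx => by
    obtain ⟨A, hA, hAS⟩ := hS x hx.1
    obtain ⟨B, hB, hBT⟩ := hT x hx.2
    obtain ⟨C, hC, hCAB⟩ := hdir A hA B hB
    exact ⟨C, hC, fun c hc => ⟨hAS c (hCAB hc).1, hBT c (hCAB hc).2⟩⟩
  isOpen_sUnion := fun 𝒮 h𝒮 x hx => by
    obtain ⟨S, hS, hxS⟩ := hx
    obtain ⟨A, hA, hAS⟩ := h𝒮 S hS x hxS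
    exact ⟨A, hA, fun a ha => ⟨S, hS, hAS a ha⟩⟩

theorem nhds_one_hasBasis {X : Type*} [Group X] (F : Set (Subgroup X))
    (hne : F.Nonempty) (hdir : ∀ A ∈ F, ∀ B ∈ F, ∃ C ∈ F, C ≤ A ⊓ B) :
    (@nhds X (subgroupFamilyTopology F hne hdir) 1).HasBasis
      (fun A : Subgroup X => A ∈ F) (fun A => (A : Set X)) := by
  let _ := subgroupFamilyTopology F hne hdir
  refine ⟨fun S => ?_⟩
  rw [mem_nhds_iff]
  constructor
  · rintro ⟨T, hTS, hT, h1⟩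
    obtain ⟨A, hA, h⟩ := hT 1 h1
    exact ⟨A, hA, fun a ha => hTS (by simpa using h a ha)⟩
  · rintro ⟨A, hA, hAS⟩
    exact ⟨A, hAS, fun x hx => ⟨A, hA, fun a ha => A.mul_mem hx ha⟩, A.one_mem⟩

end Topologies

section Automorphisms

variable (G : Type*) [Group G] [TopologicalSpace G]

/-- The group `Aut(G)` of continuous automorphisms of `G` (with continuous inverse, which is
automatic for profinite `G`), under composition. -/
instance instGroupAut : Group (G ≃ₜ* G) where
  mul α β := β.trans α
  one := ContinuousMulEquiv.refl G
  inv α := α.symm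
  mul_assoc _ _ _ := rfl
  one_mul _ := rfl
  mul_one _ := rfl
  inv_mul_cancel α := by
    ext x
    exact α.symm_apply_apply x

variable {G}

@[simp] theorem aut_mul_apply (α β : G ≃ₜ* G) (x : G) : (α * β) x = α (β x) := rfl

@[simp] theorem aut_one_apply (x : G) : (1 : G ≃ₜ* G) x = x := rfl

@[simp] theorem aut_apply_inv_apply (α : G ≃ₜ* G) (x : G) : α (α⁻¹ x) = x :=
  α.apply_symm_apply x

@[simp] theorem aut_inv_apply_apply (α : G ≃ₜ* G) (x : G) : α⁻¹ (α x) = x :=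
  α.symm_apply_apply x

/-- `A(O)`: the automorphisms `γ` with `γ(g) ≡ g mod O` for all `g`. -/
def autCongr (O : OpenSubgroup G) : Subgroup (G ≃ₜ* G) where
  carrier := {γ | ∀ g : G, g⁻¹ * γ g ∈ O}
  one_mem' := fun g => by simp [one_mem]
  mul_mem' := fun {a b} ha hb g => by
    have h := mul_mem (hb g) (ha (b g))
    simpa [mul_assoc] using h
  inv_mem' := fun {a} ha g => by
    have h := inv_mem (ha (a⁻¹ g))
    simpa using h

variable (G)

/-- The standard topology on `Aut(G)`: the subgroups `A(O)`, with `O` an open subgroup of `G`,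
form a base of neighbourhoods of the identity. -/
instance instTopologicalSpaceAut : TopologicalSpace (G ≃ₜ* G) :=
  subgroupFamilyTopology (Set.range (autCongr (G := G))) ⟨_, ⊤, rfl⟩ <| by
    rintro _ ⟨O, rfl⟩ _ ⟨P, rfl⟩
    exact ⟨_, ⟨O ⊓ P, rfl⟩, fun γ hγ => ⟨fun g => (hγ g).1, fun g => (hγ g).2⟩⟩

/-- `TAut(G)`: the virtually trivial automorphisms, i.e. those that fix pointwise some open
subgroup. -/
def TAut : Subgroup (G ≃ₜ* G) where
  carrier := {γ | ∃ W : OpenSubgroup G, ∀ x ∈ W, γ x = x}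
  one_mem' := ⟨⊤, fun _ _ => rfl⟩
  mul_mem' := by
    rintro a b ⟨V, hV⟩ ⟨W, hW⟩
    refine ⟨V ⊓ W, fun x hx => ?_⟩
    rw [aut_mul_apply, hW x hx.2, hV x hx.1]
  inv_mem' := by
    rintro a ⟨V, hV⟩
    refine ⟨V, fun x hx => ?_⟩
    conv_lhs => rw [← hV x hx]
    simp

end Automorphisms

section Commensurator

variable (G : Type u) [Group G] [TopologicalSpace G]

/-- A virtual automorphism of `G`: a topological isomorphism between two open subgroups. -/
structure VAut where
  dom : OpenSubgroup G
  cod : OpenSubgroup G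
  toEquiv : dom ≃ₜ* cod

namespace VAut

variable {G}

/-- Two virtual automorphisms are equivalent if they coincide on some open subgroup. -/
def Equivalent (φ ψ : VAut G) : Prop :=
  ∃ W : OpenSubgroup G, ∀ x ∈ W, ∃ (h : x ∈ φ.dom) (h' : x ∈ ψ.dom),
    (φ.toEquiv ⟨x, h⟩ : G) = ψ.toEquiv ⟨x, h'⟩

/-- The inverse virtual automorphism. -/
def symm (φ : VAut G) : VAut G := ⟨φ.cod, φ.dom, φ.toEquiv.symm⟩

/-- For an open subgroup `W` of `G`, the open subgroup `φ⁻¹(W ∩ cod φ)`. -/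
def preimage (φ : VAut G) (W : OpenSubgroup G) : OpenSubgroup G where
  carrier := {x | ∃ h : x ∈ φ.dom, (φ.toEquiv ⟨x, h⟩ : G) ∈ W}
  one_mem' := ⟨one_mem _, by
    have h : φ.toEquiv ⟨1, one_mem _⟩ = 1 := map_one φ.toEquiv
    rw [h]
    exact one_mem W⟩
  mul_mem' := by
    rintro a b ⟨ha, ha'⟩ ⟨hb, hb'⟩
    refine ⟨mul_mem ha hb, ?_⟩
    have h : φ.toEquiv ⟨a * b, mul_mem ha hb⟩ = φ.toEquiv ⟨a, ha⟩ * φ.toEquiv ⟨b, hb⟩ :=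
      map_mul φ.toEquiv ⟨a, ha⟩ ⟨b, hb⟩
    rw [h]
    exact mul_mem ha' hb'
  inv_mem' := by
    rintro a ⟨ha, ha'⟩
    refine ⟨inv_mem ha, ?_⟩
    have h : φ.toEquiv ⟨a⁻¹, inv_mem ha⟩ = (φ.toEquiv ⟨a, ha⟩)⁻¹ :=
      map_inv φ.toEquiv ⟨a, ha⟩
    rw [h]
    exact inv_mem ha'
  isOpen' := by
    have h1 : IsOpen {x : φ.dom | (φ.toEquiv x : G) ∈ W} :=
      W.isOpen.preimage (continuous_subtype_val.comp φ.toEquiv.continuous_toFun)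
    have h2 := φ.dom.isOpen.isOpenMap_subtype_val _ h1
    convert h2 using 1
    ext x
    constructor
    · rintro ⟨h, h'⟩
      exact ⟨⟨x, h⟩, h', rfl⟩
    · rintro ⟨⟨y, hy⟩, h', rfl⟩
      exact ⟨hy, h'⟩

theorem mem_preimage (φ : VAut G) (W : OpenSubgroup G) (x : G) :
    x ∈ φ.preimage W ↔ ∃ h : x ∈ φ.dom, (φ.toEquiv ⟨x, h⟩ : G) ∈ W := Iff.rfl

/-- The composite `φ ∘ ψ`, from `ψ⁻¹(dom φ ∩ cod ψ)` onto `φ(dom φ ∩ cod ψ)`. -/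
def comp (φ ψ : VAut G) : VAut G where
  dom := ψ.preimage φ.dom
  cod := φ.symm.preimage ψ.cod
  toEquiv :=
    { toFun := fun x =>
        ⟨φ.toEquiv ⟨ψ.toEquiv ⟨x.1, x.2.1⟩, x.2.2⟩, ⟨(φ.toEquiv _).2, by
          change ((φ.toEquiv.symm (φ.toEquiv _) : φ.dom) : G) ∈ ψ.cod
          rw [ContinuousMulEquiv.symm_apply_apply]
          exact (ψ.toEquiv _).2⟩⟩
      invFun := fun y =>
        ⟨ψ.toEquiv.symm ⟨φ.toEquiv.symm ⟨y.1, y.2.1⟩, y.2.2⟩, ⟨(ψ.toEquiv.symm _).2, by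
          change ((ψ.toEquiv (ψ.toEquiv.symm _) : ψ.cod) : G) ∈ φ.dom
          rw [ContinuousMulEquiv.apply_symm_apply]
          exact (φ.toEquiv.symm _).2⟩⟩
      left_inv := fun x => by
        apply Subtype.ext
        change ((ψ.toEquiv.symm ⟨(φ.toEquiv.symm (φ.toEquiv _) : φ.dom), _⟩ : ψ.dom) : G) = x
        simp only [ContinuousMulEquiv.symm_apply_apply, Subtype.coe_eta]
      right_inv := fun y => by
        apply Subtype.ext
        change ((φ.toEquiv ⟨(ψ.toEquiv (ψ.toEquiv.symm _) : ψ.cod), _⟩ : φ.cod) : G) = y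
        simp only [ContinuousMulEquiv.apply_symm_apply, Subtype.coe_eta]
      map_mul' := fun x y => by
        apply Subtype.ext
        have hψ := map_mul ψ.toEquiv ⟨x.1, x.2.1⟩ ⟨y.1, y.2.1⟩
        have hφ := map_mul φ.toEquiv ⟨ψ.toEquiv ⟨x.1, x.2.1⟩, x.2.2⟩
          ⟨ψ.toEquiv ⟨y.1, y.2.1⟩, y.2.2⟩
        have hφ' := congrArg (fun z : φ.cod => (z : G)) hφ
        have hψ' := congrArg (fun z : ψ.cod => (z : G)) hψ
        refine Eq.trans ?_ hφ'
        exact congrArg (fun z => (φ.toEquiv z : G)) (Subtype.ext hψ')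
      continuous_toFun := by
        refine Continuous.subtype_mk (continuous_subtype_val.comp
          (φ.toEquiv.continuous_toFun.comp (Continuous.subtype_mk (continuous_subtype_val.comp
            (ψ.toEquiv.continuous_toFun.comp
              (Continuous.subtype_mk continuous_subtype_val _))) _))) _
      continuous_invFun := by
        refine Continuous.subtype_mk (continuous_subtype_val.comp
          (ψ.toEquiv.continuous_invFun.comp (Continuous.subtype_mk (continuous_subtype_val.comp
            (φ.toEquiv.continuous_invFun.comp
              (Continuous.subtype_mk continuous_subtype_val _))) _))) _ }

theorem Equivalent.refl (φ : VAut G) : φ.Equivalent φ :=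
  ⟨φ.dom, fun _ hx => ⟨hx, hx, rfl⟩⟩

theorem Equivalent.symm {φ ψ : VAut G} : φ.Equivalent ψ → ψ.Equivalent φ := by
  rintro ⟨W, hW⟩
  refine ⟨W, fun x hx => ?_⟩
  obtain ⟨h, h', e⟩ := hW x hx
  exact ⟨h', h, e.symm⟩

theorem Equivalent.trans {φ ψ θ : VAut G} :
    φ.Equivalent ψ → ψ.Equivalent θ → φ.Equivalent θ := by
  rintro ⟨V, hV⟩ ⟨W, hW⟩
  refine ⟨V ⊓ W, fun x hx => ?_⟩
  obtain ⟨h, h', e⟩ := hV x hx.1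
  obtain ⟨k, k', e'⟩ := hW x hx.2
  exact ⟨h, k', e.trans e'⟩

theorem Equivalent.comp {φ φ' ψ ψ' : VAut G} :
    φ.Equivalent φ' → ψ.Equivalent ψ' → (φ.comp ψ).Equivalent (φ'.comp ψ') := by
  rintro ⟨V, hV⟩ ⟨W, hW⟩
  refine ⟨W ⊓ ψ.preimage V, fun x hx => ?_⟩
  obtain ⟨h, h', e⟩ := hW x hx.1
  obtain ⟨h₁, hxV⟩ := hx.2
  obtain ⟨k, k', e'⟩ := hV _ hxV
  refine ⟨⟨h, k⟩, ⟨h', e ▸ k'⟩, e'.trans ?_⟩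
  exact congrArg (fun z => (φ'.toEquiv z : G)) (Subtype.ext e)

theorem Equivalent.symm_congr {φ ψ : VAut G} :
    φ.Equivalent ψ → φ.symm.Equivalent ψ.symm := by
  rintro ⟨W, hW⟩
  refine ⟨φ.symm.preimage W, ?_⟩
  rintro y ⟨hy, hyW⟩
  obtain ⟨h, h', e⟩ := hW _ hyW
  have e1 : (φ.toEquiv ⟨φ.symm.toEquiv ⟨y, hy⟩, h⟩ : G) = y :=
    congrArg Subtype.val (φ.toEquiv.apply_symm_apply ⟨y, hy⟩)
  have e2 : (ψ.toEquiv ⟨φ.symm.toEquiv ⟨y, hy⟩, h'⟩ : G) = y := e.symm.trans e1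
  have hy' : y ∈ ψ.cod := e2 ▸ (ψ.toEquiv _).2
  refine ⟨hy, hy', ?_⟩
  have e3 : ψ.toEquiv.symm ⟨y, hy'⟩ = ⟨φ.symm.toEquiv ⟨y, hy⟩, h'⟩ := by
    rw [ContinuousMulEquiv.symm_apply_eq]
    exact Subtype.ext e2.symm
  exact (congrArg Subtype.val e3).symm

theorem symm_comp_equivalent (φ : VAut G) :
    (φ.symm.comp φ).Equivalent ⟨⊤, ⊤, ContinuousMulEquiv.refl _⟩ := by
  refine ⟨φ.dom, fun x hx => ⟨⟨hx, (φ.toEquiv ⟨x, hx⟩).2⟩, trivial, ?_⟩⟩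
  exact congrArg Subtype.val (φ.toEquiv.symm_apply_apply ⟨x, hx⟩)

/-- Equivalence of virtual automorphisms, as a setoid. -/
instance setoid : Setoid (VAut G) where
  r := Equivalent
  iseqv := ⟨Equivalent.refl, Equivalent.symm, Equivalent.trans⟩

end VAut

/-- The commensurator `Comm(G)`: virtual automorphisms of `G` up to equivalence. -/
def Comm : Type u := Quotient (VAut.setoid (G := G))

namespace Comm

variable {G}

/-- The class `[φ]` of a virtual automorphism. -/
def mk (φ : VAut G) : Comm G := Quotient.mk _ φ

/-- The group structure on `Comm(G)`: `[φ] [ψ] = [φ ∘ ψ]`. -/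
instance instGroup : Group (Comm G) where
  mul := Quotient.map₂ VAut.comp fun _ _ h _ _ h' => VAut.Equivalent.comp h h'
  one := mk ⟨⊤, ⊤, ContinuousMulEquiv.refl _⟩
  inv := Quotient.map VAut.symm fun _ _ h => VAut.Equivalent.symm_congr h
  mul_assoc := by
    rintro ⟨φ⟩ ⟨ψ⟩ ⟨θ⟩
    refine Quotient.sound ⟨θ.preimage (ψ.preimage φ.dom), ?_⟩
    rintro x ⟨h, h', h''⟩
    exact ⟨⟨h, h', h''⟩, ⟨⟨h, h'⟩, h''⟩, rfl⟩
  one_mul := by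
    rintro ⟨φ⟩
    exact Quotient.sound ⟨φ.dom, fun x hx => ⟨⟨hx, trivial⟩, hx, rfl⟩⟩
  mul_one := by
    rintro ⟨φ⟩
    exact Quotient.sound ⟨φ.dom, fun x hx => ⟨⟨trivial, hx⟩, hx, rfl⟩⟩
  inv_mul_cancel := by
    rintro ⟨φ⟩
    exact Quotient.sound φ.symm_comp_equivalent

theorem mk_mul_mk (φ ψ : VAut G) : mk φ * mk ψ = mk (φ.comp ψ) := rfl

end Comm

variable {G}

/-- The canonical homomorphism `ρ_U : Aut(U) → Comm(G)`, for an open subgroup `U` of `G`. -/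
def rho (U : OpenSubgroup G) : (U ≃ₜ* U) →* Comm G where
  toFun α := Comm.mk ⟨U, U, α⟩
  map_one' := Quotient.sound ⟨U, fun _ hx => ⟨hx, trivial, rfl⟩⟩
  map_mul' _ β := Quotient.sound ⟨U, fun x hx => ⟨hx, ⟨hx, (β ⟨x, hx⟩).2⟩, rfl⟩⟩

variable (G)

/-- The set `B_G` of the subgroups `H` of `Comm(G)` such that `ρ_O⁻¹(H)` is open in `Aut(O)` for
every open subgroup `O` of `G`. -/
def autOpenSubgroups : Set (Subgroup (Comm G)) :=
  {H | ∀ O : OpenSubgroup G, IsOpen (rho O ⁻¹' (H : Set (Comm G)))}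

/-- The Aut-topology on `Comm(G)`: the members of `B_G` form a base of neighbourhoods of `1`. -/
instance instTopologicalSpaceComm : TopologicalSpace (Comm G) :=
  subgroupFamilyTopology (autOpenSubgroups G) ⟨⊤, fun _ => isOpen_univ⟩ fun A hA B hB =>
    ⟨A ⊓ B, fun O => (hA O).inter (hB O), le_rfl⟩

/-- `G` is `Aut₁`: for every open subgroup `U`, the subgroup `TAut(U)` is closed in `Aut(U)`. -/
def IsAutOne : Prop :=
  ∀ U : OpenSubgroup G, IsClosed (TAut U : Set (U ≃ₜ* U))

variable {G}

/-- `Aut(U)_V`: the automorphisms `α` of `U` with `α(V) = V`, for `V` contained in `U`. -/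
def autStabilizer (U V : OpenSubgroup G) : Subgroup (U ≃ₜ* U) where
  carrier := {α | ∀ x : U, (α x : G) ∈ V ↔ (x : G) ∈ V}
  one_mem' := fun _ => Iff.rfl
  mul_mem' := fun {a b} ha hb x => (ha (b x)).trans (hb x)
  inv_mem' := fun {a} ha x => by
    have h := ha (a⁻¹ x)
    rw [aut_apply_inv_apply] at h
    exact h.symm

/-- The image of `Aut(U)` in `Comm(G)`. -/
def autImage (U : OpenSubgroup G) : Subgroup (Comm G) := (rho U).range

/-- The quotient topology on the image of `Aut(U)` in `Comm(G)`, as a quotient of `Aut(U)`. -/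
@[reducible] def autImageTopology (U : OpenSubgroup G) : TopologicalSpace (autImage U) :=
  TopologicalSpace.coinduced (rho U).rangeRestrict inferInstance

/-- The image of `Aut(U)_V` in `Comm(G)`. -/
def autStabilizerImage (U V : OpenSubgroup G) : Subgroup (Comm G) :=
  (autStabilizer U V).map (rho U)

/-- `U` is Aut-stable: for every open subgroup `V` of `U`, the image of `Aut(U)_V` in `Comm(G)`
(which lies in the image of `Aut(V)`) is open in the image of `Aut(V)`. -/
def IsAutStable (U : OpenSubgroup G) : Prop :=
  ∀ V : OpenSubgroup G, V ≤ U →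
    @IsOpen _ (autImageTopology V) {c : autImage V | (c : Comm G) ∈ autStabilizerImage U V}

variable (G)

/-- `G` is `Aut₂`: it is `Aut₁` and some open subgroup of `G` is Aut-stable. -/
def IsAutTwo : Prop := IsAutOne G ∧ ∃ U : OpenSubgroup G, IsAutStable U

end Commensurator

section ProP

/-- `G` is a pro-`p` group: a profinite group in which every open normal subgroup has index a power
of `p`. -/
structure IsProP (p : ℕ) (G : Type*) [Group G] [TopologicalSpace G] [IsTopologicalGroup G] :
    Prop where
  compact : CompactSpace G
  totallyDisconnected : TotallyDisconnectedSpace G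
  index_eq_pow : ∀ N : OpenNormalSubgroup G, ∃ n : ℕ, N.toSubgroup.index = p ^ n

/-- `G` is a free pro-`p` group of finite rank `r`: it is pro-`p` and has a basis `x₁, …, x_r`,
i.e. for every pro-`p` group `H`, every map from the basis to `H` extends uniquely to
a continuous homomorphism from `G` to `H`. -/
def IsFreeProP (p r : ℕ) (G : Type u) [Group G] [TopologicalSpace G] [IsTopologicalGroup G] :
    Prop :=
  IsProP p G ∧ ∃ x : Fin r → G,
    ∀ (H : Type u) [Group H] [TopologicalSpace H] [IsTopologicalGroup H], IsProP p H →
      ∀ f : Fin r → H, ∃! φ : G →ₜ* H, ∀ i, φ (x i) = f i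

end ProP

end AutTop

set_option linter.unusedSectionVars false

namespace AutTop


universe u v w

/-! ### Bases of free pro-`p` groups, tested on finite `p`-groups -/

section FreeBasis

/-! Everything rests on two facts about a free pro-`p` group `G` with at least two basis elements:
open subgroups have trivial centralizer (`eq_one_of_commute`), and open normal subgroups are again
free pro-`p` of finite rank (`exists_of_normal`). Both concern the action of `G` by conjugation on
an open normal subgroup `V`. A map to a wreath product shows that an element `t` outside `⟨x i⟩ V`
does not act on `Hom(V, ℤ/p)` as a scalar (`exists_hom_conj`).

`Aut₁`: if `γ` fixes an open normal subgroup `N` of `U` pointwise, then `g⁻¹ γ(g)` centralizes `N`,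
so it is trivial. Hence `TAut(U) = 1`, which is closed.

Not `Aut₂`: take `t ∈ U` outside `⟨x i⟩ V`, with `V ≤ U` open normal in `G`, and let `τ` be
conjugation by `t` on `V`. If `β ∈ Aut(U)` stabilizes `V` and is close to the identity there, then
`c = t⁻¹ β(t)` almost centralizes `V`, so it lies in `V` and acts trivially on abelian quotients of
`V`; thus `β` commutes with `τ` on such quotients. Since `τ` is not a scalar mod `p`, some
transvection of `V`, as close to the identity as desired, fails to do so. It is therefore not even
close to the restriction of such a `β` (`exists_aut_not_extend`).

Not locally compact: iterate along a cofinal chain of open subgroups `U n`, each characteristic in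
the previous one, so that the images `B n` of `Aut(U n)` increase in `Comm(G)`. Any open subgroup
`H` contains the class of some `h n ∈ Aut(U (n+1))` far from `B n`. Congruence subgroups `A n` of `B
n` are chosen so small that `h n ∉ B n A (n+1)`, yet compatible enough that the open subgroup they
generate meets `B n` in no more than `A 0, …, A n` generate (`inv_mul_notMem_iSup`). The `h n` lie
in distinct cosets of it, so `H` is contained in no compact set. -/

/-- The family `x` is a basis of the free pro-`p` group `G`: `G` has pro-`p` quotients, `x` generates
`G` topologically, and every map from `x` to a finite `p`-group extends to `G`. -/
structure IsFreeBasis (p : ℕ) {G : Type u} [Group G] [TopologicalSpace G] {ι : Type v}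
    (x : ι → G) : Prop where
  pow_mem : ∀ W : OpenSubgroup G, ∃ k : ℕ, ∀ g : G, g ^ p ^ k ∈ W
  dense : Dense (Subgroup.closure (Set.range x) : Set G)
  lift : ∀ (Q : Type) [Group Q] [Finite Q], IsPGroup p Q → ∀ f : ι → Q,
    ∃ φ : G →* Q, IsOpen (φ.ker : Set G) ∧ ∀ i, φ (x i) = f i

variable {p : ℕ} {G : Type u} [Group G] [TopologicalSpace G] [IsTopologicalGroup G]
  {ι : Type v} {x : ι → G}

theorem exists_openNormalSubgroup_le [CompactSpace G] [TotallyDisconnectedSpace G]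
    (W : OpenSubgroup G) : ∃ N : OpenNormalSubgroup G, ∀ g ∈ N, g ∈ W := by
  obtain ⟨N, hN⟩ := ProfiniteGrp.exist_openNormalSubgroup_sub_open_nhds_of_one W.isOpen W.one_mem
  exact ⟨N, fun g hg => hN hg⟩

theorem exists_openNormalSubgroup_notMem [CompactSpace G] [TotallyDisconnectedSpace G]
    {g : G} (hg : g ≠ 1) : ∃ N : OpenNormalSubgroup G, g ∉ N := by
  obtain ⟨N, hN⟩ := ProfiniteGrp.exist_openNormalSubgroup_sub_open_nhds_of_one
    (isOpen_compl_singleton (x := g)) (by simpa using hg.symm)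
  exact ⟨N, fun h => hN h rfl⟩

theorem finite_quotient_openNormalSubgroup [CompactSpace G] (N : OpenNormalSubgroup G) :
    Finite (G ⧸ N.toSubgroup) :=
  inferInstanceAs (Finite (G ⧸ N.toOpenSubgroup.toSubgroup))

theorem isOpen_ker_mk (N : OpenNormalSubgroup G) :
    IsOpen ((QuotientGroup.mk' N.toSubgroup).ker : Set G) := by
  rw [QuotientGroup.ker_mk']
  exact N.toOpenSubgroup.isOpen

/-- The kernel of a homomorphism with open kernel, as an open normal subgroup. -/
def kerOpen {Q : Type w} [Group Q] (φ : G →* Q) (h : IsOpen (φ.ker : Set G)) :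
    OpenNormalSubgroup G where
  toSubgroup := φ.ker
  isOpen' := h

@[simp] theorem mem_kerOpen {Q : Type w} [Group Q] (φ : G →* Q) (h : IsOpen (φ.ker : Set G))
    (g : G) : g ∈ kerOpen φ h ↔ φ g = 1 := Iff.rfl

theorem IsFreeBasis.eq_top (hx : IsFreeBasis p x) (K : Subgroup G) (hK : IsOpen (K : Set G))
    (h : ∀ i, x i ∈ K) : K = ⊤ := by
  have h1 : Subgroup.closure (Set.range x) ≤ K := by
    rw [Subgroup.closure_le]
    rintro _ ⟨i, rfl⟩
    exact h i
  have h2 : IsClosed (K : Set G) := OpenSubgroup.isClosed ⟨K, hK⟩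
  have h3 : Dense (K : Set G) := hx.dense.mono h1
  rw [← SetLike.coe_set_eq, ← h2.closure_eq, h3.closure_eq, Subgroup.coe_top]

theorem IsFreeBasis.hom_ext (hx : IsFreeBasis p x) {Q : Type w} [Group Q] {φ ψ : G →* Q}
    (hφ : IsOpen (φ.ker : Set G)) (hψ : IsOpen (ψ.ker : Set G))
    (h : ∀ i, φ (x i) = ψ (x i)) : φ = ψ := by
  have h1 : φ.eqLocus ψ = ⊤ := by
    refine hx.eq_top _ ?_ h
    refine Subgroup.isOpen_mono (H₁ := φ.ker ⊓ ψ.ker) ?_ (hφ.inter hψ)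
    rintro g ⟨h1, h2⟩
    exact (show φ g = 1 from h1).trans (show ψ g = 1 from h2).symm
  ext g
  have : g ∈ φ.eqLocus ψ := h1 ▸ Subgroup.mem_top g
  exact this

theorem IsFreeBasis.continuousMonoidHom_ext (hx : IsFreeBasis p x) {H : Type w} [Group H]
    [TopologicalSpace H] [T2Space H] {φ ψ : G →ₜ* H} (h : ∀ i, φ (x i) = ψ (x i)) : φ = ψ := by
  have h1 : Subgroup.closure (Set.range x) ≤ (φ : G →* H).eqLocus (ψ : G →* H) := by
    rw [Subgroup.closure_le]
    rintro _ ⟨i, rfl⟩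
    exact h i
  have h2 : (φ : G → H) = ψ := by
    refine Continuous.ext_on hx.dense φ.continuous_toFun ψ.continuous_toFun fun g hg => h1 hg
  exact DFunLike.coe_injective h2

theorem IsFreeBasis.exists_hom (hx : IsFreeBasis p x) (Q : Type w) [Group Q] [Finite Q]
    (hQ : IsPGroup p Q) (f : ι → Q) :
    ∃ φ : G →* Q, IsOpen (φ.ker : Set G) ∧ ∀ i, φ (x i) = f i := by
  let e : Shrink.{0} Q ≃* Q := Shrink.mulEquiv
  have : Finite (Shrink.{0} Q) := Finite.of_equiv _ e.symm.toEquiv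
  obtain ⟨φ, hφ, h⟩ := hx.lift (Shrink.{0} Q) (hQ.of_equiv e.symm) (fun i => e.symm (f i))
  refine ⟨e.toMonoidHom.comp φ, ?_, fun i => by simp [h]⟩
  convert hφ using 1
  ext g
  simp [MonoidHom.mem_ker]

theorem IsFreeBasis.isPGroup_quotient (hx : IsFreeBasis p x) (N : OpenNormalSubgroup G) :
    IsPGroup p (G ⧸ N.toSubgroup) := by
  obtain ⟨k, hk⟩ := hx.pow_mem N.toOpenSubgroup
  intro g
  obtain ⟨g, rfl⟩ := QuotientGroup.mk_surjective g
  exact ⟨k, by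
    rw [← QuotientGroup.mk_pow]
    exact (QuotientGroup.eq_one_iff _).2 (hk g)⟩

instance isTopologicalGroup_openSubgroup (U : OpenSubgroup G) : IsTopologicalGroup U :=
  inferInstanceAs (IsTopologicalGroup U.toSubgroup)

instance compactSpace_openSubgroup [CompactSpace G] (U : OpenSubgroup G) : CompactSpace U :=
  isCompact_iff_compactSpace.1 U.isClosed.isCompact

/-- An open subgroup of an open subgroup, as an open subgroup. -/
def mapOpen {G : Type u} [Group G] [TopologicalSpace G] (U : OpenSubgroup G)
    (W : OpenSubgroup U) : OpenSubgroup G where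
  toSubgroup := W.toSubgroup.map U.toSubgroup.subtype
  isOpen' := by exact U.isOpen.isOpenMap_subtype_val _ W.isOpen

theorem mem_mapOpen {U : OpenSubgroup G} {W : OpenSubgroup U} {g : G} :
    g ∈ mapOpen U W ↔ ∃ h : g ∈ U, (⟨g, h⟩ : U) ∈ W := by
  constructor
  · rintro ⟨y, hy, rfl⟩
    exact ⟨y.2, hy⟩
  · rintro ⟨h, hW⟩
    exact ⟨⟨g, h⟩, hW, rfl⟩

/-- The trace of an open subgroup on an open subgroup. -/
def comapOpen {G : Type u} [Group G] [TopologicalSpace G] (U : OpenSubgroup G)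
    (W : OpenSubgroup G) : OpenSubgroup U :=
  W.comap U.toSubgroup.subtype continuous_subtype_val

theorem pow_mem_subgroup (hx : IsFreeBasis p x) (U : OpenSubgroup G) (W : OpenSubgroup U) :
    ∃ k : ℕ, ∀ g : U, g ^ p ^ k ∈ W := by
  obtain ⟨k, hk⟩ := hx.pow_mem (mapOpen U W)
  exact ⟨k, fun g => (mem_mapOpen.1 (hk g)).2⟩

end FreeBasis

/-! ### From the universal property to a basis -/

section OfIsFreeProP

theorem isProP_of_finite (p : ℕ) [Fact p.Prime] (Q : Type u) [Group Q] [TopologicalSpace Q]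
    [IsTopologicalGroup Q] [DiscreteTopology Q] [Finite Q] (hQ : IsPGroup p Q) : IsProP p Q where
  compact := inferInstance
  totallyDisconnected := inferInstance
  index_eq_pow N := hQ.index N.toSubgroup

theorem isOpen_ker_of_discrete {G : Type u} [Group G] [TopologicalSpace G] {Q : Type v} [Group Q]
    [TopologicalSpace Q] [DiscreteTopology Q] (φ : G →ₜ* Q) :
    IsOpen ((φ : G →* Q).ker : Set G) :=
  (isOpen_discrete ({1} : Set Q)).preimage φ.continuous_toFun

variable {p r : ℕ} [Fact p.Prime] {G : Type u} [Group G] [TopologicalSpace G]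
  [IsTopologicalGroup G]

theorem IsProP.exists_pow_mem (hG : IsProP p G) (W : OpenSubgroup G) :
    ∃ k : ℕ, ∀ g : G, g ^ p ^ k ∈ W := by
  have := hG.compact
  have := hG.totallyDisconnected
  obtain ⟨N, hN⟩ := exists_openNormalSubgroup_le W
  obtain ⟨k, hk⟩ := hG.index_eq_pow N
  refine ⟨k, fun g => hN _ ?_⟩
  rw [← hk]
  exact Subgroup.pow_index_mem N.toSubgroup g

/-- Density comes from uniqueness in the universal property: a basis generating a non-dense subgroup
would lie in a proper subgroup modulo some open normal `N`, hence in a maximal one. Maximal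
subgroups of a finite `p`-group are normal, so the basis would be killed by a nontrivial map to a
finite `p`-group. -/
theorem exists_isFreeBasis (hG : IsFreeProP p r G) : ∃ x : Fin r → G, IsFreeBasis p x := by
  obtain ⟨hP, x, hx⟩ := hG
  have := hP.compact
  have := hP.totallyDisconnected
  refine ⟨x, hP.exists_pow_mem, ?_, ?_⟩
  · by_contra hd
    obtain ⟨g, hg⟩ : ∃ g, g ∉ (Subgroup.closure (Set.range x)).topologicalClosure := by
      by_contra! h
      exact hd fun g => h g
    let C : ClosedSubgroup G := ⟨(Subgroup.closure (Set.range x)).topologicalClosure,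
      Subgroup.isClosed_topologicalClosure _⟩
    have hC : (Subgroup.closure (Set.range x)).topologicalClosure = C.toSubgroup := rfl
    rw [hC, ProfiniteGrp.closedSubgroup_eq_sInf_open C] at hg
    simp only [Subgroup.mem_sInf, Set.mem_ofPred_eq, not_forall] at hg
    obtain ⟨K, ⟨hKo, hCK⟩, hgK⟩ := hg
    obtain ⟨N, hN⟩ := exists_openNormalSubgroup_le ⟨K, hKo⟩
    have hNK : N.toSubgroup ≤ K := fun g hg => hN g hg
    have := finite_quotient_openNormalSubgroup N
    have hQ : IsPGroup p (G ⧸ N.toSubgroup) := by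
      obtain ⟨k, hk⟩ := hP.index_eq_pow N
      exact IsPGroup.of_card (n := k) (by rw [← hk]; rfl)
    have hK' : K.map (QuotientGroup.mk' N.toSubgroup) ≠ ⊤ := by
      intro h
      have := congrArg (Subgroup.comap (QuotientGroup.mk' N.toSubgroup)) h
      rw [Subgroup.comap_map_eq, QuotientGroup.ker_mk', sup_eq_left.2 hNK, Subgroup.comap_top]
        at this
      exact hgK (this ▸ Subgroup.mem_top g)
    obtain ⟨M, hM, hKM⟩ := (eq_top_or_exists_le_coatom _).resolve_left hK'
    have := hQ.isNilpotent
    have hMn : M.Normal := Subgroup.NormalizerCondition.normal_of_coatom M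
      Group.normalizerCondition_of_isNilpotent hM
    let Q := (G ⧸ N.toSubgroup) ⧸ M
    let _ : TopologicalSpace Q := ⊥
    have : DiscreteTopology Q := ⟨rfl⟩
    have hQ' : IsProP p Q := isProP_of_finite p Q (hQ.to_quotient M)
    let φ : G →* Q := (QuotientGroup.mk' M).comp (QuotientGroup.mk' N.toSubgroup)
    have hφ : Continuous φ := by
      refine continuous_of_continuousAt_one φ ?_
      rw [ContinuousAt, map_one, nhds_discrete Q, Filter.tendsto_pure]
      filter_upwards [N.toOpenSubgroup.mem_nhds_one] with g hg
      have : (QuotientGroup.mk' N.toSubgroup) g = 1 := (QuotientGroup.eq_one_iff _).2 hg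
      change QuotientGroup.mk' M (QuotientGroup.mk' N.toSubgroup g) = 1
      rw [this, map_one]
    obtain ⟨_, -, huniq⟩ := hx Q hQ' (fun _ => 1)
    have h1 := huniq ⟨φ, hφ⟩ fun i => (QuotientGroup.eq_one_iff _).2 <|
      hKM ⟨x i, hCK (Subgroup.le_topologicalClosure _ (Subgroup.subset_closure ⟨i, rfl⟩)), rfl⟩
    have h2 := huniq 1 fun i => rfl
    have h3 : ∀ g, φ g = 1 := fun g => DFunLike.congr_fun (h1.trans h2.symm) g
    refine hM.1 (eq_top_iff.2 ?_)
    rintro y -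
    obtain ⟨y, rfl⟩ := QuotientGroup.mk_surjective y
    exact (QuotientGroup.eq_one_iff _).1 (h3 y)
  · intro Q _ _ hQ f
    let Q' := ULift.{u} Q
    let _ : TopologicalSpace Q' := ⊥
    have : DiscreteTopology Q' := ⟨rfl⟩
    have hQ' : IsProP p Q' := isProP_of_finite p Q' (hQ.of_equiv MulEquiv.ulift.symm)
    obtain ⟨φ, hφ, -⟩ := hx Q' hQ' fun i => ⟨f i⟩
    refine ⟨(MulEquiv.ulift.toMonoidHom).comp (φ : G →* Q'), ?_, fun i => ?_⟩
    · convert isOpen_ker_of_discrete φ using 1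
      ext g
      simp [MonoidHom.mem_ker]
    · change (φ (x i)).down = f i
      rw [hφ]

end OfIsFreeProP


/-! ### Extending homomorphisms from dense subgroups and from bases -/

section Extension

theorem exists_hom_of_denseRange {V : Type u} [Group V] [TopologicalSpace V]
    [IsTopologicalGroup V] {A : Type v} [Group A] {Q : Type w} [Group Q] {a : A →* V}
    (ha : DenseRange a) (f : A →* Q) (K : OpenNormalSubgroup V) (h : ∀ d, a d ∈ K → f d = 1) :
    ∃ θ : V →* Q, IsOpen (θ.ker : Set V) ∧ ∀ d, θ (a d) = f d := by
  let π : A →* V ⧸ K.toSubgroup := (QuotientGroup.mk' K.toSubgroup).comp a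
  have hπ : Function.Surjective π := by
    intro v
    obtain ⟨v, rfl⟩ := QuotientGroup.mk_surjective v
    obtain ⟨d, hd⟩ := ha.exists_mem_open (s := {w | v⁻¹ * w ∈ K})
      (K.toOpenSubgroup.isOpen.preimage (continuous_const_mul v⁻¹)) ⟨v, by simp [one_mem]⟩
    exact ⟨d, (QuotientGroup.eq.2 hd).symm⟩
  have hker : π.ker ≤ f.ker := fun d hd => h d ((QuotientGroup.eq_one_iff _).1 hd)
  let L := π.liftOfSurjective hπ ⟨f, hker⟩
  have hL : ∀ d, L (π d) = f d := fun d => MonoidHom.liftOfRightInverse_comp_apply _ _ _ ⟨f, hker⟩ d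
  refine ⟨L.comp (QuotientGroup.mk' K.toSubgroup), ?_, hL⟩
  refine Subgroup.isOpen_mono (H₁ := K.toSubgroup) (fun v hv => ?_) K.toOpenSubgroup.isOpen
  have : QuotientGroup.mk' K.toSubgroup v = 1 := (QuotientGroup.eq_one_iff _).2 hv
  rw [MonoidHom.mem_ker, MonoidHom.comp_apply, this, map_one]

/-- A homomorphism from a free pro-`p` group to a pro-`p` group is determined by, and can be
prescribed on, a basis. -/
theorem IsFreeBasis.exists_continuousMonoidHom {p : ℕ} {G : Type u} [Group G] [TopologicalSpace G]
    [IsTopologicalGroup G] {ι : Type v} {x : ι → G} (hx : IsFreeBasis p x)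
    {H : Type w} [Group H] [TopologicalSpace H] [IsTopologicalGroup H] [CompactSpace H]
    [TotallyDisconnectedSpace H] (hH : ∀ N : OpenNormalSubgroup H, IsPGroup p (H ⧸ N.toSubgroup))
    (f : ι → H) : ∃ φ : G →ₜ* H, ∀ i, φ (x i) = f i := by
  have h1 : ∀ N : OpenNormalSubgroup H, ∃ θ : G →* H ⧸ N.toSubgroup,
      IsOpen (θ.ker : Set G) ∧ ∀ i, θ (x i) = f i := fun N =>
    have := finite_quotient_openNormalSubgroup N
    hx.exists_hom _ (hH N) _
  choose θ hθo hθ using h1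
  have hmono : ∀ N M : OpenNormalSubgroup H, (hNM : N.toSubgroup ≤ M.toSubgroup) → ∀ (g : G) (h : H),
      θ N g = h → θ M g = h := by
    intro N M hNM g h hgh
    let q : H ⧸ N.toSubgroup →* H ⧸ M.toSubgroup :=
      QuotientGroup.map _ _ (MonoidHom.id H) hNM
    have : q.comp (θ N) = θ M := by
      refine hx.hom_ext ?_ (hθo M) fun i => ?_
      · refine Subgroup.isOpen_mono (H₁ := (θ N).ker) (fun v hv => ?_) (hθo N)
        rw [MonoidHom.mem_ker] at hv ⊢
        simp [hv]
      · simp only [MonoidHom.comp_apply, hθ]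
        rfl
    rw [← this, MonoidHom.comp_apply, hgh]
    rfl
  have hex : ∀ g : G, ∃ h : H, ∀ N, θ N g = h := by
    intro g
    have : Nonempty (OpenNormalSubgroup H) := 
      ⟨{ toOpenSubgroup := ⊤, isNormal' := inferInstanceAs (⊤ : Subgroup H).Normal }⟩
    -- The value at `g` is a common point of the cosets `θ N g`, a directed family of nonempty
    -- closed sets in a compact group.
    have := IsCompact.nonempty_iInter_of_directed_nonempty_isCompact_isClosed
      (fun N : OpenNormalSubgroup H => {h : H | θ N g = h}) ?_ ?_ ?_ ?_
    · obtain ⟨h, hh⟩ := this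
      exact ⟨h, fun N => Set.mem_iInter.1 hh N⟩
    · intro N M
      exact ⟨N ⊓ M, fun h hh => hmono _ _ inf_le_left g h hh,
        fun h hh => hmono _ _ inf_le_right g h hh⟩
    · intro N
      obtain ⟨h, hh⟩ := QuotientGroup.mk_surjective (θ N g)
      exact ⟨h, hh.symm⟩
    all_goals
      intro N
      have hc : IsClosed {h : H | θ N g = h} := by
        obtain ⟨h₀, hh⟩ := QuotientGroup.mk_surjective (θ N g)
        have : {h : H | θ N g = h} = (fun h => h₀⁻¹ * h) ⁻¹' (N.toOpenSubgroup : Set H) := by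
          ext h
          rw [Set.mem_ofPred_eq, ← hh]
          exact QuotientGroup.eq
        rw [this]
        exact N.toOpenSubgroup.isClosed.preimage (continuous_const_mul _)
      first | exact hc | exact hc.isCompact
  choose φ hφ using hex
  have hsep : ∀ a b : H, (∀ N : OpenNormalSubgroup H, (a : H ⧸ N.toSubgroup) = b) → a = b := by
    intro a b hab
    by_contra hne
    obtain ⟨N, hN⟩ := exists_openNormalSubgroup_notMem (g := a⁻¹ * b)
      (by simpa [inv_mul_eq_one] using hne)
    exact hN (QuotientGroup.eq.1 (hab N))
  let Φ : G →* H := MonoidHom.mk' φ fun a b => hsep _ _ fun N => by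
    rw [← hφ, map_mul, hφ, hφ]
    rfl
  refine ⟨⟨Φ, ?_⟩, fun i => hsep _ _ fun N => by
    rw [← hθ]
    exact (hφ (x i) N).symm⟩
  refine continuous_of_continuousAt_one Φ ?_
  intro S hS
  rw [map_one] at hS
  obtain ⟨T, hTS, hT, h1T⟩ := mem_nhds_iff.1 hS
  obtain ⟨N, hN⟩ := ProfiniteGrp.exist_openNormalSubgroup_sub_open_nhds_of_one hT h1T
  have : ((θ N).ker : Set G) ∈ nhds 1 := (hθo N).mem_nhds (one_mem (θ N).ker)
  refine Filter.mem_map.2 (Filter.mem_of_superset this fun g hg => ?_)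
  refine hTS (hN ((QuotientGroup.eq_one_iff (N := N.toSubgroup) _).1 ?_))
  exact (hφ g N).symm.trans hg

end Extension

/-! ### Open normal subgroups are free -/

section Schreier

theorem closure_range_freeGroupBasis {A : Type u} [Group A] {Y : Type v}
    (b : FreeGroupBasis Y A) : Subgroup.closure (Set.range b) = ⊤ := by
  rw [eq_top_iff]
  rintro c -
  have h : Subgroup.closure (Set.range (FreeGroup.of (α := Y))) ≤
      (Subgroup.closure (Set.range b)).comap b.repr.symm.toMonoidHom := by
    rw [Subgroup.closure_le]
    rintro _ ⟨y, rfl⟩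
    exact Subgroup.subset_closure ⟨y, rfl⟩
  have h1 := h (FreeGroup.closure_range_of Y ▸ Subgroup.mem_top (b.repr c))
  simpa using h1

/-- A finitely generated group has finitely many homomorphisms to `ℤ/2`, and these correspond to the
maps from `Y` to `ℤ/2`. -/
theorem finite_of_freeGroupBasis {A : Type u} [Group A] [Group.FG A] {Y : Type v}
    (b : FreeGroupBasis Y A) : Finite Y := by
  classical
  obtain ⟨S, hS, hfin⟩ := Group.fg_iff.1 ‹Group.FG A›
  have : Finite S := hfin
  let C := Multiplicative (ZMod 2)
  have h1 : Function.Injective fun (f : A →* C) (s : S) => f s := by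
    intro f g hfg
    exact MonoidHom.eq_of_eqOn_dense hS fun s hs => congrFun hfg ⟨s, hs⟩
  have : Finite (A →* C) := Finite.of_injective _ h1
  have : Finite (Y → C) := Finite.of_equiv _ b.lift.symm
  refine Finite.of_injective (fun y : Y => (Pi.mulSingle y (Multiplicative.ofAdd 1) : Y → C)) ?_
  intro y z h
  by_contra hne
  have h2 := congrFun h y
  simp only [Pi.mulSingle_eq_same, Pi.mulSingle_eq_of_ne hne] at h2
  exact absurd h2 (by decide)

variable {p : ℕ} {G : Type u} [Group G] [TopologicalSpace G] [IsTopologicalGroup G]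
  {ι : Type} {x : ι → G}

/-- All conjugates of `d ^ p ^ k` lie in `A`, and `f` kills their `p ^ m`-th powers, where `p ^ m =
|Q|`. So one power of `d` lies in every conjugate of `ker f`. -/
theorem isPGroup_quotient_normalCore [Fact p.Prime] {D Q : Type*} [Group D] [Group Q] [Finite Q]
    (hQ : IsPGroup p Q) (A : Subgroup D) [A.Normal] (hA : ∃ k : ℕ, ∀ d : D, d ^ p ^ k ∈ A)
    (f : A →* Q) : IsPGroup p (D ⧸ (f.ker.map A.subtype).normalCore) := by
  obtain ⟨k, hk⟩ := hA
  obtain ⟨m, hm⟩ := IsPGroup.iff_card.1 hQ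
  intro q
  obtain ⟨d, rfl⟩ := QuotientGroup.mk_surjective q
  refine ⟨k + m, ?_⟩
  rw [← QuotientGroup.mk_pow, QuotientGroup.eq_one_iff, pow_add, pow_mul]
  intro g
  have hu : g * d ^ p ^ k * g⁻¹ ∈ A := ‹A.Normal›.conj_mem _ (hk d) g
  refine ⟨⟨_, hu⟩ ^ p ^ m, ?_, ?_⟩
  · rw [SetLike.mem_coe, MonoidHom.mem_ker, map_pow, ← hm, pow_card_eq_one']
  · simp

/-- **Schreier's theorem** for open normal subgroups of free pro-`p` groups. -/
theorem IsFreeBasis.exists_of_normal [CompactSpace G] [Fact p.Prime] [Finite ι]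
    (hx : IsFreeBasis p x)
    (V : OpenSubgroup G) [hV : V.toSubgroup.Normal] :
    ∃ (d : ℕ) (y : Fin d → V), IsFreeBasis p y := by
  -- The discrete theorem is transferred from the abstract free group with dense image in `G`; `j`
  -- need not be known to be injective.
  let j : FreeGroup ι →* G := FreeGroup.lift x
  let A : Subgroup (FreeGroup ι) := V.toSubgroup.comap j
  have hAn : A.Normal := Subgroup.normal_comap _
  have hAf : A.FiniteIndex := by
    have : V.toSubgroup.FiniteIndex := V.toSubgroup.finiteIndex_of_finite_quotient
    exact ⟨by
      rw [Subgroup.index_comap]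
      exact Subgroup.FiniteIndex.index_ne_zero⟩
  let a : A →* V :=
    { toFun := fun d => ⟨j d.1, d.2⟩
      map_one' := Subtype.ext (map_one j)
      map_mul' := fun c d => Subtype.ext (map_mul j c.1 d.1) }
  have hj : (Set.range j : Set G) = Subgroup.closure (Set.range x) := by
    rw [← FreeGroup.range_lift_eq_closure]
    rfl
  have hjd : DenseRange j := by
    rw [DenseRange, hj]
    exact hx.dense
  have ha : DenseRange a := by
    refine dense_iff_inter_open.2 fun O hO ⟨o, ho⟩ => ?_
    obtain ⟨d, ⟨v, hv, e⟩⟩ := hjd.exists_mem_open (V.isOpen.isOpenMap_subtype_val _ hO) ⟨o, o, ho, rfl⟩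
    refine ⟨v, hv, ⟨d, show j d ∈ V by rw [← e]; exact v.2⟩, Subtype.ext e.symm⟩
  have hpow : ∃ k : ℕ, ∀ d : FreeGroup ι, d ^ p ^ k ∈ A := by
    obtain ⟨k, hk⟩ := hx.pow_mem V
    exact ⟨k, fun d => show j (d ^ p ^ k) ∈ V by rw [map_pow]; exact hk _⟩
  let b := IsFreeGroup.basis A
  have hfin : Finite (IsFreeGroup.Generators A) := finite_of_freeGroupBasis b
  obtain ⟨d, ⟨e⟩⟩ := Finite.exists_equiv_fin (IsFreeGroup.Generators A)
  refine ⟨d, fun i => a (b (e.symm i)), fun W => pow_mem_subgroup hx V W, ?_, ?_⟩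
  · have : (Set.range a : Set V) ⊆ Subgroup.closure (Set.range fun i => a (b (e.symm i))) := by
      rintro _ ⟨c, rfl⟩
      have h1 : (⊤ : Subgroup A) ≤ (Subgroup.closure (Set.range fun i => a (b (e.symm i)))).comap a := by
        rw [← closure_range_freeGroupBasis b, Subgroup.closure_le]
        rintro _ ⟨z, rfl⟩
        exact Subgroup.subset_closure ⟨e z, by simp⟩
      exact h1 (Subgroup.mem_top c)
    exact ha.mono this
  · intro Q _ _ hQ f
    let F : A →* Q := b.lift (f ∘ e)
    -- `F` is defined on `A` only. Modulo this core the whole free group becomes a finite `p`-group,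
    -- so the quotient map factors through `G`; this makes `F` continuous for the topology of `V`.
    let M := (F.ker.map A.subtype).normalCore
    have hM : IsPGroup p (FreeGroup ι ⧸ M) := isPGroup_quotient_normalCore hQ A hpow F
    have hMf : M.FiniteIndex := by
      have : (F.ker.map A.subtype).FiniteIndex := ⟨by
        rw [Subgroup.index_map_subtype]
        exact mul_ne_zero Subgroup.FiniteIndex.index_ne_zero Subgroup.FiniteIndex.index_ne_zero⟩
      infer_instance
    obtain ⟨φ, hφ, h⟩ := hx.exists_hom (FreeGroup ι ⧸ M) hM fun i => (FreeGroup.of i : FreeGroup ι)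
    have hφj : φ.comp j = QuotientGroup.mk' M := by
      ext i
      simp [j, h]
    let K : OpenNormalSubgroup V := kerOpen (φ.comp V.toSubgroup.subtype) <| by
      exact hφ.preimage continuous_subtype_val
    obtain ⟨θ, hθ, hθa⟩ := exists_hom_of_denseRange ha F K fun c hc => by
      have h1 : φ (j c) = 1 := hc
      rw [← MonoidHom.comp_apply, hφj] at h1
      have h2 : (c : FreeGroup ι) ∈ M := (QuotientGroup.eq_one_iff _).1 h1
      obtain ⟨c', hc', e⟩ := Subgroup.normalCore_le _ h2
      have : c' = c := Subtype.ext e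
      exact this ▸ hc'
    refine ⟨θ, hθ, fun i => ?_⟩
    rw [hθa]
    simp [F]

end Schreier


/-- Conjugation by an element of `G`, as an automorphism of an open normal subgroup. -/
def conjAut {G : Type u} [Group G] [TopologicalSpace G] [IsTopologicalGroup G] (V : OpenSubgroup G)
    [hV : V.toSubgroup.Normal] (t : G) : V ≃ₜ* V where
  toFun v := ⟨t * v * t⁻¹, hV.conj_mem _ v.2 t⟩
  invFun v := ⟨t⁻¹ * v * t, by simpa using hV.conj_mem _ v.2 t⁻¹⟩
  left_inv v := by ext; simp [mul_assoc]
  right_inv v := by ext; simp [mul_assoc]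
  map_mul' v w := by ext; simp [mul_assoc]
  continuous_toFun := by fun_prop
  continuous_invFun := by fun_prop

@[simp] theorem coe_conjAut {G : Type u} [Group G] [TopologicalSpace G] [IsTopologicalGroup G]
    (V : OpenSubgroup G) [V.toSubgroup.Normal] (t : G) (v : V) :
    (conjAut V t v : G) = t * v * t⁻¹ := rfl

/-! ### Conjugation detected by wreath products -/

section Wreath

variable {C Q : Type*} [CommGroup C] [Group Q]

/-- The base component of the `n`-th power is a product of translates of a function supported at `1`
by powers of `q`, so it is supported on `⟨q⟩`. -/
theorem wreath_pow_left_eq_one [DecidableEq Q] (c : C) (q y : Q) (hy : y ∉ Subgroup.zpowers q)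
    (n : ℕ) : ((⟨Pi.mulSingle 1 c, q⟩ : RegularWreathProduct C Q) ^ n).left y = 1 := by
  induction n generalizing y with
  | zero => simp
  | succ n ih =>
    have h1 : y ≠ 1 := fun h => hy (h ▸ one_mem _)
    have h2 : q⁻¹ * y ∉ Subgroup.zpowers q := fun h =>
      hy (by simpa using mul_mem (Subgroup.mem_zpowers q) h)
    rw [pow_succ', RegularWreathProduct.mul_left, Pi.mul_apply, ih _ h2]
    simp [h1]

theorem wreath_pow_right (a : RegularWreathProduct C Q) (n : ℕ) : (a ^ n).right = a.right ^ n :=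
  map_pow (RegularWreathProduct.rightHom : RegularWreathProduct C Q →* Q) a n

/-- Of the translates by `1, q, …, q ^ n`, only the first is supported at `1`, as long as `n` is
less than the order of `q`. -/
theorem wreath_pow_left_one [DecidableEq Q] (c : C) (q : Q) (n : ℕ) (hn : n < orderOf q) :
    ((⟨Pi.mulSingle 1 c, q⟩ : RegularWreathProduct C Q) ^ (n + 1)).left 1 = c := by
  induction n with
  | zero => simp
  | succ n ih =>
    have h1 : (q ^ (n + 1))⁻¹ ≠ 1 := by
      rw [inv_ne_one]
      exact pow_ne_one_of_lt_orderOf (Nat.succ_ne_zero n) hn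
    rw [pow_succ, RegularWreathProduct.mul_left, Pi.mul_apply, ih (by omega), wreath_pow_right]
    simp only [mul_one]
    rw [Pi.mulSingle_eq_of_ne h1, mul_one]

theorem wreath_conj_left (g b : RegularWreathProduct C Q) (hb : b.right = 1) :
    (g * b * g⁻¹).left 1 = b.left g.right⁻¹ := by
  simp [hb]

end Wreath

variable {p : ℕ} [Fact p.Prime] {G : Type u} [Group G] [TopologicalSpace G] [IsTopologicalGroup G]
  [CompactSpace G] {ι : Type} {x : ι → G}

/-- An element `t` outside of `⟨x i⟩ V` is detected by the action of `G` on `Hom(V, ℤ/p)`. -/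
theorem IsFreeBasis.exists_hom_conj (hx : IsFreeBasis p x) (V : OpenSubgroup G)
    [hV : V.toSubgroup.Normal] (i₀ : ι) (t : G) (ht : ∀ a : ℤ, (x i₀ ^ a)⁻¹ * t ∉ V) :
    ∃ (θ : V →* Multiplicative (ZMod p)) (v : V), IsOpen (θ.ker : Set V) ∧ θ v ≠ 1 ∧
      θ (conjAut V t v) = 1 := by
  classical
  let C := Multiplicative (ZMod p)
  let N : OpenNormalSubgroup G := { toOpenSubgroup := V, isNormal' := hV }
  let Q := G ⧸ V.toSubgroup
  have hQf : Finite Q := finite_quotient_openNormalSubgroup N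
  have hQ : IsPGroup p Q := hx.isPGroup_quotient N
  have hC : Nat.card C = p := by simp [C]
  have hp1 : 1 < p := (Fact.out : p.Prime).one_lt
  have : NeZero p := ⟨by omega⟩
  have : Finite C := inferInstanceAs (Finite (ZMod p))
  obtain ⟨m, hm⟩ := IsPGroup.iff_card.1 hQ
  have hW : IsPGroup p (RegularWreathProduct C Q) := by
    refine IsPGroup.of_card (n := p ^ m + m) ?_
    rw [RegularWreathProduct.card, hC, hm, pow_add]
  let π : G →* Q := QuotientGroup.mk' V.toSubgroup
  have hπ1 : ∀ v : V, π v = 1 := fun v => (QuotientGroup.eq_one_iff _).2 v.2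
  let c : C := Multiplicative.ofAdd 1
  -- On `V` the coordinates of the base component are homomorphisms to `ℤ/p`, permuted by
  -- conjugation in `G`. Only `x i₀` receives a nontrivial base component, supported at `1`.
  obtain ⟨Ψ, hΨo, hΨ⟩ := hx.exists_hom (RegularWreathProduct C Q) hW
    fun i => ⟨if i = i₀ then Pi.mulSingle 1 c else 1, π (x i)⟩
  have hr : RegularWreathProduct.rightHom.comp Ψ = π := by
    refine hx.hom_ext ?_ (isOpen_ker_mk N) fun i => ?_
    · exact Subgroup.isOpen_mono (H₁ := Ψ.ker) (fun g hg => by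
        rw [MonoidHom.mem_ker] at hg ⊢
        rw [MonoidHom.comp_apply, hg, map_one]) hΨo
    · rw [MonoidHom.comp_apply, hΨ]
      rfl
  have hr' : ∀ g, (Ψ g).right = π g := fun g => DFunLike.congr_fun hr g
  let θ : V →* C := MonoidHom.mk' (fun v => (Ψ v).left 1) fun a b => by
    have := hr' a
    rw [hπ1] at this
    simp [this]
  have hx0 : Ψ (x i₀) = ⟨Pi.mulSingle 1 c, π (x i₀)⟩ := by rw [hΨ, if_pos rfl]
  -- `x i₀ ^ q` lies in `V`; its coordinate at `1` is `c`, and its coordinates off `⟨π (x i₀)⟩`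
  -- vanish. Conjugation by `t` moves the coordinate at `(π t)⁻¹`, outside this subgroup, to `1`.
  let q := orderOf (π (x i₀))
  have hq : 0 < q := orderOf_pos _
  have hv : x i₀ ^ q ∈ V := by
    refine (QuotientGroup.eq_one_iff (N := V.toSubgroup) _).1 ?_
    exact (map_pow π _ _).trans (pow_orderOf_eq_one _)
  refine ⟨θ, ⟨_, hv⟩, ?_, ?_, ?_⟩
  · refine Subgroup.isOpen_mono (H₁ := Ψ.ker.comap V.toSubgroup.subtype) (fun g hg => ?_)
      (hΨo.preimage continuous_subtype_val)
    have h1 : Ψ g = 1 := hg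
    change (Ψ g).left 1 = 1
    rw [h1]
    rfl
  · change (Ψ (x i₀ ^ q)).left 1 ≠ 1
    obtain ⟨n, hn⟩ := Nat.exists_eq_succ_of_ne_zero hq.ne'
    rw [map_pow, hx0, hn, wreath_pow_left_one _ _ _ (by omega)]
    have : Fact (1 < p) := ⟨hp1⟩
    exact fun h => one_ne_zero (α := ZMod p) (Multiplicative.ofAdd.injective h)
  · change (Ψ (t * x i₀ ^ q * t⁻¹)).left 1 = 1
    have h1 : (Ψ (x i₀ ^ q)).right = 1 := (hr' _).trans (hπ1 ⟨_, hv⟩)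
    rw [map_mul, map_mul, map_inv, wreath_conj_left _ _ h1, map_pow, hx0,
      wreath_pow_left_eq_one]
    rw [hr', inv_mem_iff]
    rintro ⟨a, ha⟩
    exact ht a (QuotientGroup.eq.1 ((map_zpow π _ _).trans ha))

theorem isPGroup_multiplicative_zmod (p k : ℕ) [Fact p.Prime] :
    IsPGroup p (Multiplicative (ZMod (p ^ k))) :=
  IsPGroup.of_card (n := k) (by simp)

instance finite_multiplicative_zmod (p k : ℕ) [Fact p.Prime] :
    Finite (Multiplicative (ZMod (p ^ k))) :=
  have : NeZero (p ^ k) := ⟨pow_ne_zero _ (Fact.out : p.Prime).ne_zero⟩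
  inferInstanceAs (Finite (ZMod (p ^ k)))

/-- The homomorphism to `ℤ/p^k` dual to an element of a basis. -/
theorem IsFreeBasis.exists_dual (hx : IsFreeBasis p x) (i : ι) (k : ℕ) :
    ∃ φ : G →* Multiplicative (ZMod (p ^ k)), IsOpen (φ.ker : Set G) ∧
      φ (x i) = Multiplicative.ofAdd 1 ∧ ∀ j ≠ i, φ (x j) = 1 := by
  classical
  obtain ⟨φ, hφ, h⟩ := hx.exists_hom _ (isPGroup_multiplicative_zmod p k)
    (Pi.mulSingle i (Multiplicative.ofAdd 1))
  exact ⟨φ, hφ, by simp [h], fun j hj => by simp [h, hj]⟩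

theorem IsFreeBasis.exists_notMem_zpowers_mul (hx : IsFreeBasis p x) {i₀ i₁ : ι} (hi : i₁ ≠ i₀)
    (U : OpenSubgroup G) : ∃ (K : OpenNormalSubgroup G), ∃ t ∈ U, ∀ V : OpenSubgroup G,
      (∀ v ∈ V, v ∈ K) → ∀ a : ℤ, (x i₀ ^ a)⁻¹ * t ∉ V := by
  obtain ⟨k, hk⟩ := hx.pow_mem U
  obtain ⟨φ, hφo, hφ1, hφ0⟩ := hx.exists_dual i₁ (k + 1)
  -- The exponent `k` puts `t` in `U`; since `φ` takes values mod `p ^ (k + 1)`, it does not kill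
  -- `t`, while it kills `x i₀`.
  refine ⟨kerOpen φ hφo, x i₁ ^ p ^ k, hk _, fun V hV a ha => ?_⟩
  have h1 := (mem_kerOpen φ hφo _).1 (hV _ ha)
  rw [map_mul, map_inv, map_zpow, hφ0 _ hi.symm, one_zpow, inv_one, one_mul, map_pow, hφ1,
    ← ofAdd_nsmul, nsmul_one, ofAdd_eq_one, ZMod.natCast_eq_zero_iff] at h1
  have := (Nat.pow_dvd_pow_iff_le_right (Fact.out : p.Prime).one_lt).1 h1
  omega

/-! ### Centralizers of open subgroups -/

variable [TotallyDisconnectedSpace G]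

/-- An element commuting with `W ≤ N` acts trivially on `Hom(W, ℤ/p)`, so it lies in `⟨x i⟩ W` for
every `i`. Comparing two indices through a dual homomorphism makes the exponent divisible by `p ^
k`, hence the element trivial modulo an arbitrary `W'`. -/
theorem IsFreeBasis.eq_one_of_commute [Nontrivial ι] (hx : IsFreeBasis p x) (N : OpenSubgroup G)
    (c : G) (hc : ∀ v ∈ N, c * v = v * c) : c = 1 := by
  by_contra hc1
  obtain ⟨i₀, i₁, hi⟩ := exists_pair_ne ι
  obtain ⟨W', hW'⟩ := exists_openNormalSubgroup_notMem hc1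
  obtain ⟨N', hN'⟩ := exists_openNormalSubgroup_le N
  obtain ⟨k, hk⟩ := hx.pow_mem W'.toOpenSubgroup
  obtain ⟨φ, hφo, hφ1, hφ0⟩ := hx.exists_dual i₀ k
  let W := (N' ⊓ W') ⊓ kerOpen φ hφo
  have key : ∀ i, ∃ a : ℤ, (x i ^ a)⁻¹ * c ∈ W := by
    intro i
    by_contra! h
    obtain ⟨θ, v, -, h1, h2⟩ := hx.exists_hom_conj W.toOpenSubgroup i c h
    have : conjAut W.toOpenSubgroup c v = v := by
      ext
      rw [coe_conjAut, hc _ (hN' _ v.2.1.1), mul_inv_cancel_right]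
    rw [this] at h2
    exact h1 h2
  obtain ⟨a, ha⟩ := key i₀
  obtain ⟨b, hb⟩ := key i₁
  have ha1 := (mem_kerOpen φ hφo _).1 ha.2
  have hb1 := (mem_kerOpen φ hφo _).1 hb.2
  rw [map_mul, map_inv, map_zpow, hφ0 _ hi.symm, one_zpow, inv_one, one_mul] at hb1
  rw [map_mul, hb1, mul_one, map_inv, inv_eq_one, map_zpow, hφ1, ← ofAdd_zsmul, zsmul_one,
    ofAdd_eq_one, ZMod.intCast_zmod_eq_zero_iff_dvd] at ha1
  obtain ⟨e, rfl⟩ := ha1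
  have h3 : x i₀ ^ ((p ^ k : ℕ) * e : ℤ) ∈ W' := by
    rw [zpow_mul, zpow_natCast]
    exact zpow_mem (hk _ : x i₀ ^ p ^ k ∈ W') e
  have h4 : (x i₀ ^ ((p ^ k : ℕ) * e : ℤ))⁻¹ * c ∈ W' := ha.1.2
  exact hW' (by simpa using mul_mem h3 h4)

/-- A uniform version of the triviality of centralizers, by compactness: elements outside `P` that
centralize `N` modulo every `Q` would accumulate at an element centralizing `N`. -/
theorem IsFreeBasis.exists_commutator_le [Nontrivial ι] (hx : IsFreeBasis p x)
    (N P : OpenSubgroup G) : ∃ Q : OpenNormalSubgroup G,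
      ∀ c : G, (∀ v ∈ N, c * v * c⁻¹ * v⁻¹ ∈ Q) → c ∈ P := by
  by_contra! h
  have : Nonempty (OpenNormalSubgroup G) :=
    ⟨{ toOpenSubgroup := ⊤, isNormal' := inferInstanceAs (⊤ : Subgroup G).Normal }⟩
  have hcl : ∀ Q : OpenNormalSubgroup G,
      IsClosed {c : G | (∀ v ∈ N, c * v * c⁻¹ * v⁻¹ ∈ Q) ∧ c ∉ P} := by
    intro Q
    have : {c : G | (∀ v ∈ N, c * v * c⁻¹ * v⁻¹ ∈ Q) ∧ c ∉ P} =
        (⋂ v ∈ N, (fun c : G => c * v * c⁻¹ * v⁻¹) ⁻¹' (Q.toOpenSubgroup : Set G)) ∩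
          (P : Set G)ᶜ := by
      ext c
      simp only [Set.mem_inter_iff, Set.mem_iInter]
      rfl
    rw [this]
    refine IsClosed.inter ?_ P.isOpen.isClosed_compl
    refine isClosed_iInter fun v => isClosed_iInter fun _ => ?_
    exact Q.toOpenSubgroup.isClosed.preimage (by fun_prop)
  obtain ⟨c, hc⟩ := IsCompact.nonempty_iInter_of_directed_nonempty_isCompact_isClosed
    (fun Q : OpenNormalSubgroup G => {c : G | (∀ v ∈ N, c * v * c⁻¹ * v⁻¹ ∈ Q) ∧ c ∉ P})
    (fun Q Q' => ⟨Q ⊓ Q', fun c hc => ⟨fun v hv => (hc.1 v hv).1, hc.2⟩,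
      fun c hc => ⟨fun v hv => (hc.1 v hv).2, hc.2⟩⟩) h (fun Q => (hcl Q).isCompact) hcl
  replace hc := fun Q => Set.mem_iInter.1 hc Q
  have h1 : c = 1 := by
    refine hx.eq_one_of_commute N c fun v hv => ?_
    by_contra hne
    obtain ⟨Q, hQ⟩ := exists_openNormalSubgroup_notMem (g := c * v * c⁻¹ * v⁻¹) (fun h => hne (by
      rwa [mul_inv_eq_one, mul_inv_eq_iff_eq_mul] at h))
    exact hQ ((hc Q).1 v hv)
  exact (hc (Classical.arbitrary _)).2 (h1 ▸ one_mem P)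

/-! ### Characteristic open subgroups as intersections of kernels -/

section CharacteristicKernel

/-- The intersection of the kernels of the continuous homomorphisms to a discrete group. -/
def homKernel (U : Type u) [Group U] [TopologicalSpace U] (Q : Type v) [Group Q] : Subgroup U :=
  ⨅ φ : {φ : U →* Q // IsOpen (φ.ker : Set U)}, φ.1.ker

theorem mem_homKernel {U : Type u} [Group U] [TopologicalSpace U] {Q : Type v} [Group Q] {g : U} :
    g ∈ homKernel U Q ↔ ∀ φ : U →* Q, IsOpen (φ.ker : Set U) → φ g = 1 := by
  simp [homKernel, Subgroup.mem_iInf, MonoidHom.mem_ker]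

theorem apply_mem_homKernel {U : Type u} [Group U] [TopologicalSpace U] {Q : Type v} [Group Q]
    (α : U ≃ₜ* U) {g : U} (hg : g ∈ homKernel U Q) : α g ∈ homKernel U Q := by
  rw [mem_homKernel] at hg ⊢
  intro φ hφ
  exact hg (φ.comp (α : U →* U)) (hφ.preimage α.continuous_toFun)

-- Homomorphisms with open kernel are determined on the finite basis, so finitely many kernels are
-- intersected.
omit [CompactSpace G] [TotallyDisconnectedSpace G] in
theorem IsFreeBasis.isOpen_homKernel [Finite ι] (hx : IsFreeBasis p x) (Q : Type v) [Group Q]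
    [Finite Q] : IsOpen (homKernel G Q : Set G) := by
  have : Finite {φ : G →* Q // IsOpen (φ.ker : Set G)} := by
    refine Finite.of_injective (β := ι → Q) (fun φ i => φ.1 (x i)) fun φ ψ h => Subtype.ext ?_
    exact hx.hom_ext φ.2 ψ.2 fun i => congrFun h i
  rw [homKernel, Subgroup.coe_iInf]
  exact isOpen_iInter_of_finite fun φ => φ.2

omit [CompactSpace G] [TotallyDisconnectedSpace G] in
theorem homKernel_le (N : OpenNormalSubgroup G) :
    homKernel G (G ⧸ N.toSubgroup) ≤ N.toSubgroup := fun _ hg =>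
  (QuotientGroup.eq_one_iff _).1 (mem_homKernel.1 hg _ (isOpen_ker_mk N))

/-- By Cayley's theorem every finite quotient embeds in some `Perm (Fin n)`. Symmetric groups thus
give a sequence of subgroups cofinal among all open ones. -/
theorem homKernel_perm_le (W : OpenSubgroup G) :
    ∃ n : ℕ, homKernel G (Equiv.Perm (Fin n)) ≤ W.toSubgroup := by
  obtain ⟨N, hN⟩ := exists_openNormalSubgroup_le W
  have := finite_quotient_openNormalSubgroup N
  obtain ⟨n, ⟨e⟩⟩ := Finite.exists_equiv_fin (G ⧸ N.toSubgroup)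
  refine ⟨n, fun g hg => hN g ?_⟩
  let π := QuotientGroup.mk' N.toSubgroup
  let ρ : G ⧸ N.toSubgroup →* Equiv.Perm (Fin n) :=
    e.permCongrHom.toMonoidHom.comp (MulAction.toPermHom (G ⧸ N.toSubgroup) (G ⧸ N.toSubgroup))
  have h1 : ρ (π g) = 1 := by
    refine mem_homKernel.1 hg (ρ.comp π) ?_
    refine Subgroup.isOpen_mono (H₁ := π.ker) (fun v hv => ?_) (isOpen_ker_mk N)
    rw [MonoidHom.mem_ker] at hv ⊢
    rw [MonoidHom.comp_apply, hv, map_one]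
  have h2 : MulAction.toPermHom (G ⧸ N.toSubgroup) (G ⧸ N.toSubgroup) (π g) = 1 :=
    e.permCongrHom.injective (h1.trans (map_one e.permCongrHom).symm)
  have h3 : π g = 1 := by
    simpa using DFunLike.congr_fun h2 (1 : G ⧸ N.toSubgroup)
  exact (QuotientGroup.eq_one_iff _).1 h3

end CharacteristicKernel


/-! ### Restriction of automorphisms -/

section Restriction

variable {G : Type u} [Group G] [TopologicalSpace G] {U V : OpenSubgroup G}

/-- The restriction to `V` of an automorphism of `U` which stabilizes `V`. -/
def restrictAut (hVU : V ≤ U) (β : U ≃ₜ* U) (hβ : β ∈ autStabilizer U V) : V ≃ₜ* V where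
  toFun z := ⟨β ⟨z, hVU z.2⟩, (hβ ⟨z, hVU z.2⟩).2 z.2⟩
  invFun z := ⟨β⁻¹ ⟨z, hVU z.2⟩, (inv_mem hβ ⟨z, hVU z.2⟩).2 z.2⟩
  left_inv z := by simp
  right_inv z := by simp
  map_mul' z w := by
    apply Subtype.ext
    exact congrArg (fun u : U => (u : G)) (map_mul β ⟨z, hVU z.2⟩ ⟨w, hVU w.2⟩)
  continuous_toFun := Continuous.subtype_mk (continuous_subtype_val.comp
    (β.continuous_toFun.comp (Continuous.subtype_mk continuous_subtype_val _))) _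
  continuous_invFun := Continuous.subtype_mk (continuous_subtype_val.comp
    (β⁻¹.continuous_toFun.comp (Continuous.subtype_mk continuous_subtype_val _))) _

theorem rho_restrictAut (hVU : V ≤ U) (β : U ≃ₜ* U) (hβ : β ∈ autStabilizer U V) :
    rho V (restrictAut hVU β hβ) = rho U β :=
  Quotient.sound ⟨V, fun _ hz => ⟨hz, hVU hz, rfl⟩⟩

end Restriction

/-! ### Transvections and scalar automorphisms -/

section Transvection

variable {p : ℕ} [Fact p.Prime] {G : Type u} [Group G] [TopologicalSpace G] [IsTopologicalGroup G]
  [CompactSpace G] [TotallyDisconnectedSpace G] {ι : Type} {x : ι → G}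

/-- The automorphism of a free pro-`p` group which multiplies one element of a basis by a power of
another one. -/
theorem IsFreeBasis.exists_transvection (hx : IsFreeBasis p x) {i j : ι} (hij : i ≠ j) (n : ℕ) :
    ∃ h : G ≃ₜ* G, h (x i) = x i * x j ^ n ∧ ∀ k ≠ i, h (x k) = x k := by
  classical
  obtain ⟨φ, hφ⟩ := hx.exists_continuousMonoidHom hx.isPGroup_quotient
    (Function.update x i (x i * x j ^ n))
  obtain ⟨ψ, hψ⟩ := hx.exists_continuousMonoidHom hx.isPGroup_quotient
    (Function.update x i (x i * (x j ^ n)⁻¹))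
  have hφi : φ (x i) = x i * x j ^ n := by rw [hφ, Function.update_self]
  have hψi : ψ (x i) = x i * (x j ^ n)⁻¹ := by rw [hψ, Function.update_self]
  have hφk : ∀ k ≠ i, φ (x k) = x k := fun k hk => by rw [hφ, Function.update_of_ne hk]
  have hψk : ∀ k ≠ i, ψ (x k) = x k := fun k hk => by rw [hψ, Function.update_of_ne hk]
  have h1 : ψ.comp φ = ContinuousMonoidHom.id G := by
    refine hx.continuousMonoidHom_ext fun k => ?_
    change ψ (φ (x k)) = x k
    by_cases hk : k = i
    · rw [hk, hφi, map_mul, map_pow, hψi, hψk _ hij.symm, inv_mul_cancel_right]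
    · rw [hφk _ hk, hψk _ hk]
  have h2 : φ.comp ψ = ContinuousMonoidHom.id G := by
    refine hx.continuousMonoidHom_ext fun k => ?_
    change φ (ψ (x k)) = x k
    by_cases hk : k = i
    · rw [hk, hψi, map_mul, map_inv, map_pow, hφi, hφk _ hij.symm, mul_inv_cancel_right]
    · rw [hψk _ hk, hφk _ hk]
  exact ⟨{  toFun := φ
            invFun := ψ
            left_inv := fun g => DFunLike.congr_fun h1 g
            right_inv := fun g => DFunLike.congr_fun h2 g
            map_mul' := map_mul φ
            continuous_toFun := φ.continuous_toFun
            continuous_invFun := ψ.continuous_toFun }, hφi, hφk⟩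

theorem IsFreeBasis.inv_mul_apply_mem (hx : IsFreeBasis p x) (N : OpenNormalSubgroup G)
    (h : G ≃ₜ* G) (hN : ∀ i, (x i)⁻¹ * h (x i) ∈ N) (g : G) : g⁻¹ * h g ∈ N := by
  let π := QuotientGroup.mk' N.toSubgroup
  have h1 : π = π.comp (h : G →* G) := by
    refine hx.hom_ext (isOpen_ker_mk N) ?_ fun i => QuotientGroup.eq.2 (hN i)
    exact (isOpen_ker_mk N).preimage h.continuous_toFun
  exact QuotientGroup.eq.1 (DFunLike.congr_fun h1 g)

theorem IsFreeBasis.exists_dual_prime (hx : IsFreeBasis p x) (i : ι) :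
    ∃ φ : G →* Multiplicative (ZMod p), IsOpen (φ.ker : Set G) ∧
      φ (x i) = Multiplicative.ofAdd 1 ∧ ∀ j ≠ i, φ (x j) = 1 := by
  have := hx.exists_dual i 1
  rwa [pow_one] at this

/-- An automorphism which does not act as a scalar on `Hom(G, ℤ/p)` has a non-zero off-diagonal
entry, or two distinct diagonal entries. -/
theorem IsFreeBasis.exists_entry_ne [Finite ι] (hx : IsFreeBasis p x) (τ : G ≃ₜ* G)
    (θ : G →* Multiplicative (ZMod p)) (hθ : IsOpen (θ.ker : Set G)) (v : G) (hv : θ v ≠ 1)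
    (hτ : θ (τ v) = 1) (e : ι → G →* Multiplicative (ZMod p))
    (heo : ∀ i, IsOpen ((e i).ker : Set G))
    (he1 : ∀ i, e i (x i) = Multiplicative.ofAdd 1) (he0 : ∀ i, ∀ j ≠ i, e i (x j) = 1) :
    ∃ i j, i ≠ j ∧ (e i (τ (x j)) ≠ 1 ∨ e i (τ (x i)) ≠ e j (τ (x j))) := by
  classical
  by_contra! H
  have := Fintype.ofFinite ι
  let ξ : G →* Multiplicative (ZMod p) := MonoidHom.mk' (fun w =>
    Multiplicative.ofAdd (∑ i, (θ (x i)).toAdd * (e i w).toAdd)) fun a b => by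
      simp [mul_add, Finset.sum_add_distrib]
  have hξa : ∀ w, (ξ w).toAdd = ∑ i, (θ (x i)).toAdd * (e i w).toAdd := fun _ => rfl
  have hξo : IsOpen (ξ.ker : Set G) := by
    have h1 : IsOpen ((⨅ i, (e i).ker : Subgroup G) : Set G) := by
      rw [Subgroup.coe_iInf]
      exact isOpen_iInter_of_finite heo
    refine Subgroup.isOpen_mono (fun w hw => ?_) h1
    rw [Subgroup.mem_iInf] at hw
    rw [MonoidHom.mem_ker]
    have : ∀ i, e i w = 1 := hw
    apply Multiplicative.toAdd.injective
    rw [hξa]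
    simp [this]
  have hξ : θ = ξ := by
    refine hx.hom_ext hθ hξo fun k => ?_
    apply Multiplicative.toAdd.injective
    rw [hξa, Finset.sum_eq_single k (fun i _ hik => by rw [he0 i k hik.symm]; simp) (by simp), he1]
    simp
  -- This serves only to pick an index.
  obtain ⟨i₀, -⟩ : ∃ i, θ (x i) ≠ 1 := by
    by_contra! h
    have : θ = 1 := hx.hom_ext hθ (by
      have : ((1 : G →* Multiplicative (ZMod p)).ker : Set G) = Set.univ := by
        ext; simp
      rw [this]
      exact isOpen_univ) h
    exact hv (by rw [this]; rfl)
  -- By `H`, the matrix of `τ` is the scalar `l`, so `θ ∘ τ = l θ`. Evaluation at `v` forces `l =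
  -- 0`, against the surjectivity of `τ`.
  let l : ZMod p := (e i₀ (τ (x i₀))).toAdd
  have hl : ∀ i, (e i (τ (x i))).toAdd = l := by
    intro i
    by_cases h : i = i₀
    · rw [h]
    · rw [(H i i₀ h).2]
  let ζ : G →* Multiplicative (ZMod p) := MonoidHom.mk' (fun w =>
    Multiplicative.ofAdd (l * (θ w).toAdd)) fun a b => by simp [mul_add]
  have hζ : θ.comp (τ : G →* G) = ζ := by
    refine hx.hom_ext (hθ.preimage τ.continuous_toFun) ?_ fun k => ?_
    · refine Subgroup.isOpen_mono (fun w hw => ?_) hθ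
      rw [MonoidHom.mem_ker] at hw ⊢
      simp [ζ, hw]
    · apply Multiplicative.toAdd.injective
      change (θ (τ (x k))).toAdd = l * (θ (x k)).toAdd
      conv_lhs => rw [hξ]
      rw [hξa, Finset.sum_eq_single k (fun i _ hik => by rw [(H i k hik).1]; simp) (by simp), hl,
        mul_comm]
  have hζ' : ∀ w, (θ (τ w)).toAdd = l * (θ w).toAdd := fun w =>
    congrArg Multiplicative.toAdd (DFunLike.congr_fun hζ w)
  have h2 := hζ' v
  rw [hτ, toAdd_one, eq_comm, mul_eq_zero] at h2
  have hl0 : l = 0 := h2.resolve_right fun h => hv (Multiplicative.toAdd.injective h)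
  have h3 := hζ' (τ.symm v)
  rw [hl0, zero_mul, ContinuousMulEquiv.apply_symm_apply] at h3
  exact hv (Multiplicative.toAdd.injective h3)

end Transvection

theorem ZMod.castHom_eq_zero_of_pow_mul {p s : ℕ} [Fact p.Prime] {a : ZMod (p ^ (s + 1))}
    (h : (p ^ s : ℕ) * a = 0) : ZMod.castHom (dvd_pow_self p s.succ_ne_zero) (ZMod p) a = 0 := by
  obtain ⟨b, rfl⟩ := ZMod.intCast_surjective a
  have h1 : (((p ^ s : ℕ) * b : ℤ) : ZMod (p ^ (s + 1))) = 0 := by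
    push_cast at h ⊢
    exact h
  rw [ZMod.intCast_zmod_eq_zero_iff_dvd] at h1
  rw [map_intCast, ZMod.intCast_zmod_eq_zero_iff_dvd]
  push_cast at h1
  rw [pow_succ] at h1
  exact Int.dvd_of_mul_dvd_mul_left (pow_ne_zero _ (by exact_mod_cast (Fact.out : p.Prime).ne_zero)) h1

/-! ### Automorphisms of `V` far from those of `U` -/

section NotExtending

variable {p : ℕ} [Fact p.Prime] {G : Type u} [Group G] [TopologicalSpace G] [IsTopologicalGroup G]
  [CompactSpace G] [TotallyDisconnectedSpace G] {ι : Type} [Finite ι] [Nontrivial ι] {x : ι → G}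

omit [Nontrivial ι] in
/-- A free pro-`p` group `V` with an automorphism `τ` which is not a scalar modulo `p` has
transvections, arbitrarily close to the identity, which do not commute with `τ` on an abelian
quotient of `V`. -/
theorem IsFreeBasis.exists_aut_not_commute (hx : IsFreeBasis p x) (τ : G ≃ₜ* G)
    (θ : G →* Multiplicative (ZMod p)) (hθ : IsOpen (θ.ker : Set G)) (v : G) (hv : θ v ≠ 1)
    (hτ : θ (τ v) = 1) (O : OpenSubgroup G) :
    ∃ h ∈ autCongr O, ∃ (k : ℕ) (e : G →* Multiplicative (ZMod (p ^ k))),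
      IsOpen (e.ker : Set G) ∧ ∃ z, e (h (τ z)) ≠ e (τ (h z)) := by
  choose f hfo hf1 hf0 using hx.exists_dual_prime
  obtain ⟨i, j, hij, H⟩ := hx.exists_entry_ne τ θ hθ v hv hτ f hfo hf1 hf0
  obtain ⟨N, hN⟩ := exists_openNormalSubgroup_le O
  obtain ⟨s, hs⟩ := hx.pow_mem N.toOpenSubgroup
  -- The exponent `p ^ s` brings `h` into the congruence subgroup. The dual maps are taken mod `p ^
  -- (s + 1)`, where `p ^ s` times an entry still determines that entry mod `p`.
  obtain ⟨h, hhi, hhk⟩ := hx.exists_transvection hij (p ^ s)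
  choose e heo he1 he0 using fun i => hx.exists_dual i (s + 1)
  refine ⟨h, fun g => hN _ (hx.inv_mul_apply_mem N h (fun k => ?_) g), s + 1, e j, heo j, ?_⟩
  · by_cases hk : k = i
    · rw [hk, hhi, inv_mul_cancel_left]
      exact hs _
    · rw [hhk _ hk, inv_mul_cancel]
      exact one_mem N
  by_contra! hc
  have hej : ∀ w, e j (h w) = e j w * e i w ^ p ^ s := by
    have : (e j).comp (h : G →* G) = e j * (e i) ^ p ^ s := by
      refine hx.hom_ext ((heo j).preimage h.continuous_toFun) ?_ fun k => ?_
      · refine Subgroup.isOpen_mono (H₁ := (e j).ker ⊓ (e i).ker) (fun w hw => ?_)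
          ((heo j).inter (heo i))
        have h1 : e j w = 1 := hw.1
        have h2 : e i w = 1 := hw.2
        simp [MonoidHom.mem_ker, h1, h2]
      · change e j (h (x k)) = e j (x k) * e i (x k) ^ p ^ s
        by_cases hk : k = i
        · rw [hk, hhi, map_mul, map_pow, he1, he1]
        · rw [hhk _ hk, he0 i k hk, one_pow, mul_one]
    exact fun w => DFunLike.congr_fun this w
  have hred : ∀ (i : ι) w, (f i w).toAdd =
      ZMod.castHom (dvd_pow_self p s.succ_ne_zero) (ZMod p) (e i w).toAdd := by
    intro i w
    have : f i = (AddMonoidHom.toMultiplicative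
        (ZMod.castHom (dvd_pow_self p s.succ_ne_zero) (ZMod p)).toAddMonoidHom).comp (e i) := by
      refine hx.hom_ext (hfo i) ?_ fun k => ?_
      · refine Subgroup.isOpen_mono (fun w hw => ?_) (heo i)
        rw [MonoidHom.mem_ker] at hw ⊢
        rw [MonoidHom.comp_apply, hw, map_one]
      · rw [MonoidHom.comp_apply]
        by_cases hk : k = i
        · rw [hk, hf1, he1]
          apply Multiplicative.toAdd.injective
          exact (map_one (ZMod.castHom (dvd_pow_self p s.succ_ne_zero) (ZMod p))).symm
        · rw [hf0 _ _ hk, he0 _ _ hk, map_one]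
    rw [this]
    rfl
  -- By `hej`, commutation at `x j` kills `p ^ s` times the off-diagonal entry, and commutation at
  -- `x i` equates `p ^ s` times the two diagonal entries.
  have hj := hc (x j)
  rw [hhk j hij.symm, hej, mul_eq_left] at hj
  have hi := hc (x i)
  rw [hhi, hej, map_mul τ, map_mul, mul_right_inj, map_pow τ, map_pow (e j)] at hi
  rcases H with H | H
  · apply H
    apply Multiplicative.toAdd.injective
    rw [hred, toAdd_one]
    refine ZMod.castHom_eq_zero_of_pow_mul ?_
    rw [← nsmul_eq_mul, ← toAdd_pow, hj, toAdd_one]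
  · apply H
    apply Multiplicative.toAdd.injective
    rw [hred, hred, ← sub_eq_zero, ← map_sub]
    refine ZMod.castHom_eq_zero_of_pow_mul ?_
    rw [mul_sub, ← nsmul_eq_mul, ← nsmul_eq_mul, ← toAdd_pow, ← toAdd_pow, hi, sub_self]

/-- Arbitrarily close to the identity, `V` has automorphisms which are not close to
any automorphism of `U`. -/
theorem IsFreeBasis.exists_aut_not_extend (hx : IsFreeBasis p x) {U V : OpenSubgroup G}
    [hV : V.toSubgroup.Normal] (hVU : V ≤ U) {i₀ : ι} {t : G} (htU : t ∈ U)
    (ht : ∀ a : ℤ, (x i₀ ^ a)⁻¹ * t ∉ V) (O : OpenSubgroup V) :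
    ∃ h ∈ autCongr O, ∃ P : OpenSubgroup V, ∀ (β : U ≃ₜ* U) (hβ : β ∈ autStabilizer U V),
      ¬ ∀ z : V, (h z)⁻¹ * restrictAut hVU β hβ z ∈ P := by
  obtain ⟨d, y, hy⟩ := hx.exists_of_normal V
  obtain ⟨θ, v, hθ, hv, hτ⟩ := hx.exists_hom_conj V i₀ t ht
  obtain ⟨Q, hQ⟩ := hx.exists_commutator_le V V
  let Q' : OpenSubgroup V := comapOpen V Q.toOpenSubgroup
  let τ := conjAut V t
  obtain ⟨h, hh, k, e, he, z, hz⟩ := hy.exists_aut_not_commute τ θ hθ v hv hτ (O ⊓ Q')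
  -- The factor `Q'` keeps `b` close to the identity; the two kernels make `b` agree with `h` under
  -- `e` and under `e ∘ τ`.
  refine ⟨h, fun g => (hh g).1, Q' ⊓ (kerOpen e he).toOpenSubgroup ⊓
    (kerOpen (e.comp (τ : V →* V)) (he.preimage τ.continuous_toFun)).toOpenSubgroup, ?_⟩
  intro β hβ H
  let b := restrictAut hVU β hβ
  have hbQ : ∀ z : V, (z : G)⁻¹ * b z ∈ Q := fun z => by
    have := mul_mem (hh z).2 (H z).1.1
    rw [mul_assoc, mul_inv_cancel_left] at this
    exact this
  have heb : ∀ z : V, e (b z) = e (h z) := fun z => by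
    have : e ((h z)⁻¹ * b z) = 1 := (H z).1.2
    rw [map_mul, map_inv, inv_mul_eq_one] at this
    exact this.symm
  have heτb : ∀ z : V, e (τ (b z)) = e (τ (h z)) := fun z => by
    have : e (τ ((h z)⁻¹ * b z)) = 1 := (H z).2
    rw [map_mul, map_inv, map_mul, map_inv, inv_mul_eq_one] at this
    exact this.symm
  let t' : U := ⟨t, htU⟩
  have hconj : ∀ z : V, (b (τ z) : G) = β t' * b z * (β t' : G)⁻¹ := fun z => by
    have : (⟨τ z, hVU (τ z).2⟩ : U) = t' * ⟨z, hVU z.2⟩ * t'⁻¹ := Subtype.ext rfl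
    change (β ⟨τ z, hVU (τ z).2⟩ : G) = _
    rw [this, map_mul, map_mul, map_inv]
    rfl
  -- Modulo `Q`, `b` is the identity, so `t` and `β t` act alike on `V`; their quotient centralizes
  -- `V` modulo `Q`.
  have hc : t⁻¹ * (β t' : G) ∈ V := by
    refine hQ _ fun v hv => ?_
    let π := QuotientGroup.mk' Q.toSubgroup
    have hπ : ∀ z : V, π (b z) = π z := fun z => (QuotientGroup.eq.2 (hbQ z)).symm
    have h1 := congrArg π (hconj ⟨v, hv⟩)
    rw [hπ, map_mul, map_mul, hπ, coe_conjAut] at h1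
    refine (QuotientGroup.eq_one_iff (N := Q.toSubgroup) _).1 ?_
    change π _ = 1
    simp only [map_mul, map_inv] at h1 ⊢
    rw [mul_inv_eq_one]
    calc (π t)⁻¹ * π (β t') * π v * ((π t)⁻¹ * π (β t'))⁻¹
        = (π t)⁻¹ * (π (β t') * π v * (π (β t'))⁻¹) * π t := by group
      _ = π v := by rw [← h1]; group
  let c : V := ⟨_, hc⟩
  -- Since `c ∈ V`, the abelian-valued map `e ∘ τ` does not see conjugation by `c`, so `e (b (τ z))
  -- = e (τ (b z))`.
  have h2 : b (τ z) = τ (c * b z * c⁻¹) := by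
    ext
    rw [hconj, coe_conjAut]
    simp [c, mul_assoc]
  apply hz
  rw [← heb, h2, ← heτb]
  simp

end NotExtending


/-! ### Open sets in `Aut(U)` and `Comm(G)` -/

section OpenSets

theorem isOpen_aut_iff {U : Type u} [Group U] [TopologicalSpace U] {S : Set (U ≃ₜ* U)} :
    IsOpen S ↔ ∀ α ∈ S, ∃ O : OpenSubgroup U, ∀ a ∈ autCongr O, α * a ∈ S := by
  change (∀ α ∈ S, ∃ A ∈ Set.range (autCongr (G := U)), ∀ a ∈ A, α * a ∈ S) ↔ _
  simp only [Set.exists_range_iff]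

theorem isOpen_of_autCongr_le {U : Type u} [Group U] [TopologicalSpace U]
    {S : Subgroup (U ≃ₜ* U)} (O : OpenSubgroup U) (hO : autCongr O ≤ S) :
    IsOpen (S : Set (U ≃ₜ* U)) :=
  isOpen_aut_iff.2 fun _ hα => ⟨O, fun _ ha => mul_mem hα (hO ha)⟩

theorem isOpen_leftCoset {G : Type u} [Group G] [TopologicalSpace G] {M : Subgroup (Comm G)}
    (hM : M ∈ autOpenSubgroups G) (c : Comm G) : IsOpen {x | c⁻¹ * x ∈ M} := by
  change ∀ x ∈ {x | c⁻¹ * x ∈ M}, ∃ A ∈ autOpenSubgroups G, ∀ a ∈ A, x * a ∈ {x | c⁻¹ * x ∈ M}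
  intro x hx
  refine ⟨M, hM, fun a ha => ?_⟩
  change c⁻¹ * (x * a) ∈ M
  rw [← mul_assoc]
  exact mul_mem hx ha

theorem nhds_one_comm_hasBasis {G : Type u} [Group G] [TopologicalSpace G] :
    (nhds (1 : Comm G)).HasBasis (fun A => A ∈ autOpenSubgroups G) (fun A => (A : Set (Comm G))) :=
  nhds_one_hasBasis (autOpenSubgroups G) ⟨⊤, fun _ => isOpen_univ⟩ fun A hA B hB =>
    ⟨A ⊓ B, fun O => (hA O).inter (hB O), le_rfl⟩

end OpenSets

/-! ### `Aut₁` and the failure of `Aut₂` -/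

section VirtuallyTrivial

variable {p : ℕ} [Fact p.Prime] {G : Type u} [Group G] [TopologicalSpace G] [IsTopologicalGroup G]
  [CompactSpace G] [TotallyDisconnectedSpace G] {ι : Type} [Nontrivial ι] {x : ι → G}

/-- If `γ` fixes the normal subgroup `N` pointwise, then `g` and `γ g` act alike on `N` by
conjugation, so `g⁻¹ γ g` centralizes an open subgroup. -/
theorem IsFreeBasis.TAut_eq_bot (hx : IsFreeBasis p x) (U : OpenSubgroup G) : TAut U = ⊥ := by
  rw [eq_bot_iff]
  rintro γ ⟨W, hW⟩
  obtain ⟨N, hN⟩ := exists_openNormalSubgroup_le W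
  rw [Subgroup.mem_bot]
  ext g
  have h1 : ((g⁻¹ * γ g : U) : G) = 1 := by
    refine hx.eq_one_of_commute (mapOpen U N.toOpenSubgroup) _ fun v hv => ?_
    obtain ⟨hvU, hvN⟩ := mem_mapOpen.1 hv
    let v' : U := ⟨v, hvU⟩
    have h2 : g * v' * g⁻¹ ∈ N := N.isNormal'.conj_mem _ hvN g
    have h3 := hW _ (hN _ h2)
    rw [map_mul, map_mul, map_inv, hW _ (hN _ hvN)] at h3
    have h4 : g⁻¹ * γ g * v' = v' * (g⁻¹ * γ g) := by
      calc g⁻¹ * γ g * v' = g⁻¹ * (γ g * v' * (γ g)⁻¹) * γ g := by group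
        _ = v' * (g⁻¹ * γ g) := by rw [h3]; group
    exact congrArg Subtype.val h4
  have h2 : g⁻¹ * γ g = 1 := Subtype.ext h1
  exact congrArg Subtype.val (inv_mul_eq_one.1 h2).symm

theorem IsFreeBasis.rho_injective (hx : IsFreeBasis p x) (U : OpenSubgroup G) :
    Function.Injective (rho U) := by
  rw [injective_iff_map_eq_one]
  intro α hα
  obtain ⟨W, hW⟩ := Quotient.exact hα
  have : α ∈ TAut U := by
    refine ⟨comapOpen U W, fun z hz => ?_⟩
    obtain ⟨h, h', e⟩ := hW _ hz
    exact Subtype.ext e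
  rwa [hx.TAut_eq_bot, Subgroup.mem_bot] at this

theorem IsFreeBasis.isAutOne (hx : IsFreeBasis p x) : IsAutOne G := by
  intro U
  rw [hx.TAut_eq_bot, ← isOpen_compl_iff, isOpen_aut_iff]
  intro γ hγ
  obtain ⟨g, hg⟩ : ∃ g, γ g ≠ g := by
    by_contra! h
    exact hγ (Subgroup.mem_bot.2 (ContinuousMulEquiv.ext h))
  obtain ⟨N, hN⟩ := exists_openNormalSubgroup_notMem (g := g⁻¹ * γ g)
    (fun h => hg (inv_mul_eq_one.1 h).symm)
  refine ⟨N.toOpenSubgroup, fun a ha h => hN ?_⟩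
  have h1 : γ = a⁻¹ := eq_inv_of_mul_eq_one_left (Subgroup.mem_bot.1 h)
  exact h1 ▸ inv_mem ha g

theorem IsFreeBasis.not_isAutTwo [Finite ι] (hx : IsFreeBasis p x) : ¬ IsAutTwo G := by
  rintro ⟨-, U, hU⟩
  obtain ⟨i₀, i₁, hi⟩ := exists_pair_ne ι
  obtain ⟨K, t, htU, ht⟩ := hx.exists_notMem_zpowers_mul hi.symm U
  obtain ⟨V, hV⟩ := exists_openNormalSubgroup_le (U ⊓ K.toOpenSubgroup)
  have hVU : V.toOpenSubgroup ≤ U := fun v hv => (hV v hv).1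
  have h1 := hU V.toOpenSubgroup hVU
  have h2 : IsOpen {a : V.toOpenSubgroup ≃ₜ* V.toOpenSubgroup |
      rho V.toOpenSubgroup a ∈ autStabilizerImage U V.toOpenSubgroup} := isOpen_coinduced.1 h1
  obtain ⟨O, hO⟩ := isOpen_aut_iff.1 h2 1 (by
    rw [Set.mem_ofPred_eq, map_one]
    exact one_mem _)
  obtain ⟨h, hh, P, hP⟩ := hx.exists_aut_not_extend hVU htU
    (ht V.toOpenSubgroup fun v hv => (hV v hv).2) O
  obtain ⟨β, hβ, e⟩ := hO h hh
  rw [one_mul, ← rho_restrictAut hVU β hβ] at e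
  have e' := hx.rho_injective _ e
  exact hP β hβ fun z => by simp [e']

/-- The restriction of automorphisms to an open normal subgroup is an embedding. -/
theorem IsFreeBasis.exists_autCongr_of_restrict (hx : IsFreeBasis p x) {U V : OpenSubgroup G}
    [hVn : V.toSubgroup.Normal] (hVU : V ≤ U) (P : OpenSubgroup U) :
    ∃ Q : OpenSubgroup V, ∀ (β : U ≃ₜ* U) (hβ : β ∈ autStabilizer U V),
      restrictAut hVU β hβ ∈ autCongr Q → β ∈ autCongr P := by
  -- If `β` is trivial on `V` modulo `Q`, then `g⁻¹ β g` centralizes `V` modulo `Q`.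
  obtain ⟨Q, hQ⟩ := hx.exists_commutator_le V (mapOpen U P)
  refine ⟨comapOpen V Q.toOpenSubgroup, fun β hβ hb g => ?_⟩
  refine (mem_mapOpen.1 (hQ (g⁻¹ * β g : U) fun v hv => ?_)).2
  let π := QuotientGroup.mk' Q.toSubgroup
  have hπ : ∀ z : V, π (β ⟨z, hVU z.2⟩) = π z := fun z => by
    have h : (z : G)⁻¹ * β ⟨z, hVU z.2⟩ ∈ Q.toSubgroup := hb z
    exact (QuotientGroup.eq.2 h).symm
  let v' : U := ⟨v, hVU hv⟩
  have h1 := hπ (conjAut V g ⟨v, hv⟩)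
  have h2 : (⟨conjAut V g ⟨v, hv⟩, hVU (conjAut V g ⟨v, hv⟩).2⟩ : U) = g * v' * g⁻¹ :=
    Subtype.ext rfl
  have h3 : ((β (g * v' * g⁻¹) : U) : G) = β g * β v' * (β g : G)⁻¹ := by
    rw [map_mul, map_mul, map_inv]
    rfl
  have h4 : π (β v') = π v := hπ ⟨v, hv⟩
  rw [h2, h3, coe_conjAut] at h1
  simp only [map_mul, map_inv, h4] at h1
  refine (QuotientGroup.eq_one_iff (N := Q.toSubgroup) _).1 ?_
  change π ((g : G)⁻¹ * β g * v * ((g : G)⁻¹ * β g)⁻¹ * v⁻¹) = 1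
  simp only [map_mul, map_inv]
  rw [mul_inv_eq_one]
  calc (π g)⁻¹ * π (β g) * π v * ((π g)⁻¹ * π (β g))⁻¹
      = (π g)⁻¹ * (π (β g) * π v * (π (β g))⁻¹) * π g := by group
    _ = π v := by rw [h1]; group

end VirtuallyTrivial

/-! ### Small characteristic subgroups -/

section Characteristic

variable {p : ℕ} [Fact p.Prime] {G : Type u} [Group G] [TopologicalSpace G] [IsTopologicalGroup G]
  [CompactSpace G] [TotallyDisconnectedSpace G] {ι : Type} [Finite ι] {x : ι → G}

theorem IsFreeBasis.exists_characteristic (hx : IsFreeBasis p x) (W : OpenSubgroup G) :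
    ∃ P : OpenSubgroup G, P ≤ W ∧ ∀ α : G ≃ₜ* G, ∀ g ∈ P, α g ∈ P := by
  obtain ⟨N, hN⟩ := exists_openNormalSubgroup_le W
  have := finite_quotient_openNormalSubgroup N
  exact ⟨⟨homKernel G (G ⧸ N.toSubgroup), hx.isOpen_homKernel _⟩,
    fun g hg => hN g (homKernel_le N hg), fun α g hg => apply_mem_homKernel α hg⟩

/-- A free pro-`p` group of finite rank has a countable base of neighbourhoods of the identity. -/
theorem IsFreeBasis.exists_seq_le (hx : IsFreeBasis p x) :
    ∃ W : ℕ → OpenSubgroup G, ∀ O : OpenSubgroup G, ∃ n, W n ≤ O :=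
  ⟨fun n => ⟨homKernel G (Equiv.Perm (Fin n)), hx.isOpen_homKernel _⟩, homKernel_perm_le⟩

/-- The inductive step for the chain: a characteristic subgroup of the normal subgroup `U` is normal
in `G`, so the construction can be repeated inside it. -/
theorem IsFreeBasis.exists_characteristic_normal [Nontrivial ι] (hx : IsFreeBasis p x)
    (U W : OpenSubgroup G) [hU : U.toSubgroup.Normal] :
    ∃ V : OpenSubgroup G, V.toSubgroup.Normal ∧ V ≤ U ∧ V ≤ W ∧ autStabilizer U V = ⊤ ∧
      ∃ (i₀ : ι), ∃ t ∈ U, ∀ a : ℤ, (x i₀ ^ a)⁻¹ * t ∉ V := by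
  obtain ⟨i₀, i₁, hi⟩ := exists_pair_ne ι
  obtain ⟨K, t, htU, ht⟩ := hx.exists_notMem_zpowers_mul hi.symm U
  obtain ⟨d, y, hy⟩ := hx.exists_of_normal U
  obtain ⟨P, hP, hPc⟩ := hy.exists_characteristic (comapOpen U (W ⊓ K.toOpenSubgroup))
  have hPV : ∀ v ∈ mapOpen U P, v ∈ W ⊓ K.toOpenSubgroup := fun v hv =>
    hP (mem_mapOpen.1 hv).2
  refine ⟨mapOpen U P, ⟨fun v hv g => ?_⟩, fun v hv => (mem_mapOpen.1 hv).1,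
    fun v hv => (hPV v hv).1, ?_, i₀, t, htU, ht _ fun v hv => (hPV v hv).2⟩
  · obtain ⟨hvU, hvP⟩ := mem_mapOpen.1 hv
    exact mem_mapOpen.2 ⟨_, hPc (conjAut U g) _ hvP⟩
  · rw [eq_top_iff]
    rintro α - z
    constructor
    · intro h
      have := hPc α⁻¹ _ (mem_mapOpen.1 h).2
      rw [Subtype.coe_eta, aut_inv_apply_apply] at this
      exact mem_mapOpen.2 ⟨z.2, this⟩
    · intro h
      exact mem_mapOpen.2 ⟨(α z).2, hPc α _ (mem_mapOpen.1 h).2⟩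

end Characteristic

/-! ### Separated sequences in an increasing union of groups -/

section Chain

/-- In an increasing union of groups `B i` with subgroups `A i`, a sequence which leaves `B i A (i+1)`
at every step is separated by the cosets of the union of the `A i`. -/
theorem inv_mul_notMem_iSup {X : Type u} [Group X] {A B : ℕ → Subgroup X} (hAB : ∀ i, A i ≤ B i)
    (hB : Monotone B) (hn : ∀ i, B i ≤ Subgroup.normalizer (A i : Set X))
    (hi : ∀ i, A (i + 1) ⊓ B i ≤ A i) {h : ℕ → X} (hh : ∀ i, h i ∈ B (i + 1))
    (hne : ∀ i, ∀ b ∈ B i, ∀ a ∈ A (i + 1), h i ≠ b * a) {m n : ℕ} (hmn : m < n) :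
    (h m)⁻¹ * h n ∉ ⨆ i, A i := by
  have hMB : ∀ i, partialSups A i ≤ B i := fun i =>
    partialSups_le _ _ _ fun j hj => (hAB j).trans (hB hj)
  have hmem : ∀ i g, g ∈ partialSups A (i + 1) → ∃ b ∈ partialSups A i, ∃ a ∈ A (i + 1),
      b * a = g := by
    intro i g hg
    rw [partialSups_add_one] at hg
    have := Subgroup.coe_mul_of_left_le_normalizer_right (partialSups A i) (A (i + 1))
      ((hMB i).trans ((hB i.le_succ).trans (hn (i + 1))))
    rw [← SetLike.mem_coe, this] at hg
    exact Set.mem_mul.1 hg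
  -- An element of `B i` in the span of `A 0, …, A (i + k)` is already in the span of `A 0, …, A i`:
  -- its last factor lies in both `A (i + k)` and `B (i + k - 1)`, so it can be absorbed one level
  -- lower.
  have hdesc : ∀ k i g, g ∈ B i → g ∈ partialSups A (i + k) → g ∈ partialSups A i := by
    intro k
    induction k with
    | zero => exact fun i g _ hg => hg
    | succ k ih =>
      intro i g hgB hg
      refine ih i g hgB ?_
      obtain ⟨b, hb, a, ha, rfl⟩ := hmem _ _ hg
      have h1 : b * a ∈ B (i + k) := hB (Nat.le_add_right i k) hgB
      have h2 : a ∈ B (i + k) := ((B (i + k)).mul_mem_cancel_left (hMB _ hb)).1 h1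
      exact mul_mem hb (le_partialSups A (i + k) (hi _ ⟨ha, h2⟩))
  intro hmem'
  rw [← iSup_partialSups_eq, Subgroup.mem_iSup_of_directed (partialSups A).monotone.directed_le]
    at hmem'
  obtain ⟨k, hk⟩ := hmem'
  have h1 : (h m)⁻¹ * h n ∈ B (n + 1) :=
    mul_mem (inv_mem (hB (by omega) (hh m))) (hh n)
  have h2 := hdesc k (n + 1) _ h1 ((partialSups A).monotone (by omega) hk)
  obtain ⟨b, hb, a, ha, e⟩ := hmem _ _ h2
  refine hne n (h m * b) (mul_mem (hB (by omega) (hh m)) (hMB _ hb)) a ha ?_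
  rw [mul_assoc, e, mul_inv_cancel_left]

theorem autImage_le_normalizer {G : Type u} [Group G] [TopologicalSpace G] {U : OpenSubgroup G}
    {P : OpenSubgroup U} (hP : ∀ α : U ≃ₜ* U, ∀ g ∈ P, α g ∈ P) :
    autImage U ≤ Subgroup.normalizer ((autCongr P).map (rho U) : Set (Comm G)) := by
  have hn : (autCongr P).Normal := ⟨fun γ hγ α g => by
    have := hP α _ (hγ (α⁻¹ g))
    simpa using this⟩
  rintro _ ⟨α, rfl⟩
  rw [Subgroup.mem_normalizer_iff]
  intro c
  constructor
  · rintro ⟨γ, hγ, rfl⟩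
    exact ⟨α * γ * α⁻¹, hn.conj_mem _ hγ α, by simp⟩
  · rintro ⟨γ, hγ, e⟩
    refine ⟨α⁻¹ * γ * α⁻¹⁻¹, hn.conj_mem _ hγ α⁻¹, ?_⟩
    rw [inv_inv, map_mul, map_mul, e, map_inv]
    group

end Chain

/-! ### The commensurator is not locally compact -/

section NotLocallyCompact

variable {p : ℕ} [Fact p.Prime] {G : Type u} [Group G] [TopologicalSpace G] [IsTopologicalGroup G]
  [CompactSpace G] [TotallyDisconnectedSpace G] {ι : Type} [Finite ι] [Nontrivial ι] {x : ι → G}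

omit [TotallyDisconnectedSpace G] [CompactSpace G] in
/-- The automorphisms of `O` congruent to the identity modulo an open subgroup of `U ≤ O` restrict
to `U`. -/
theorem map_autCongr_le {O U : OpenSubgroup G} (hUO : U ≤ O) (P : OpenSubgroup U) :
    (autCongr (comapOpen O (mapOpen U P))).map (rho O) ≤ (autCongr P).map (rho U) := by
  rintro _ ⟨α, hα, rfl⟩
  have h1 : ∀ g : O, (g : G)⁻¹ * α g ∈ mapOpen U P := hα
  have h2 : α ∈ autStabilizer O U := fun g => by
    have h3 := (mem_mapOpen.1 (h1 g)).1
    have h4 : (α g : G) = g * ((g : G)⁻¹ * α g) := by group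
    rw [h4]
    exact U.toSubgroup.mul_mem_cancel_right h3
  refine ⟨restrictAut hUO α h2, fun z => ?_, rho_restrictAut hUO α h2⟩
  exact (mem_mapOpen.1 (h1 ⟨z, hUO z.2⟩)).2

theorem IsFreeBasis.not_locallyCompactSpace (hx : IsFreeBasis p x) :
    ¬ LocallyCompactSpace (Comm G) := by
  intro hlc
  obtain ⟨K, hK, hK1⟩ := exists_compact_mem_nhds (1 : Comm G)
  obtain ⟨H, hH, hHK⟩ := nhds_one_comm_hasBasis.mem_iff.1 hK1
  obtain ⟨W, hW⟩ := hx.exists_seq_le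
  choose next hnext_normal hnext_le hnext_W hnext_char hnext using
    fun (n : ℕ) (U : {U : OpenSubgroup G // U.toSubgroup.Normal}) =>
      have := U.2
      hx.exists_characteristic_normal U.1 (W n)
  let U' : ℕ → {U : OpenSubgroup G // U.toSubgroup.Normal} := fun n =>
    Nat.rec ⟨⊤, inferInstanceAs (⊤ : Subgroup G).Normal⟩ (fun n U => ⟨next n U, hnext_normal n U⟩) n
  let U : ℕ → OpenSubgroup G := fun n => (U' n).1
  have hUn : ∀ n, (U n).toSubgroup.Normal := fun n => (U' n).2
  have hUle : ∀ n, U (n + 1) ≤ U n := fun n => hnext_le n (U' n)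
  have hUW : ∀ n, U (n + 1) ≤ W n := fun n => hnext_W n (U' n)
  have hUst : ∀ n (β : U n ≃ₜ* U n), β ∈ autStabilizer (U n) (U (n + 1)) := fun n β =>
    (hnext_char n (U' n)).symm ▸ Subgroup.mem_top β
  have hUt : ∀ n, ∃ (i₀ : ι), ∃ t ∈ U n, ∀ a : ℤ, (x i₀ ^ a)⁻¹ * t ∉ U (n + 1) :=
    fun n => hnext n (U' n)
  -- `H` is open on `Aut(U (n+1))`, so it contains automorphisms that no element of `Aut(U n)`
  -- approximates.
  have hex : ∀ n, ∃ h : U (n + 1) ≃ₜ* U (n + 1), rho (U (n + 1)) h ∈ H ∧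
      ∃ P : OpenSubgroup (U (n + 1)), ∀ β : U n ≃ₜ* U n,
        ¬ ∀ z, (h z)⁻¹ * restrictAut (hUle n) β (hUst n β) z ∈ P := by
    intro n
    obtain ⟨O, hO⟩ := isOpen_aut_iff.1 (hH (U (n + 1))) 1 (by
      rw [Set.mem_preimage, map_one]
      exact one_mem H)
    obtain ⟨i₀, t, htU, ht⟩ := hUt n
    obtain ⟨h, hh, P, hP⟩ := hx.exists_aut_not_extend (hUle n) htU ht O
    refine ⟨h, ?_, P, fun β => hP β (hUst n β)⟩
    have := hO h hh
    rwa [one_mul] at this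
  choose h hhH R hR using hex
  -- The three conditions give `h n ∉ B n A (n+1)`, normality of `A (n+1)` in `B (n+1)`, and `A
  -- (n+1) ⊓ B n ≤ A n`.
  have hstep : ∀ n (P : OpenSubgroup (U n)), ∃ P' : OpenSubgroup (U (n + 1)),
      P' ≤ R n ∧ (∀ α : U (n + 1) ≃ₜ* U (n + 1), ∀ g ∈ P', α g ∈ P') ∧
      ∀ β : U n ≃ₜ* U n, restrictAut (hUle n) β (hUst n β) ∈ autCongr P' → β ∈ autCongr P := by
    intro n P
    obtain ⟨Q, hQ⟩ := hx.exists_autCongr_of_restrict (hUle n) P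
    obtain ⟨d, y, hy⟩ := hx.exists_of_normal (U (n + 1))
    obtain ⟨P', hP', hc⟩ := hy.exists_characteristic (R n ⊓ Q)
    exact ⟨P', fun g hg => (hP' hg).1, hc, fun β hβ => hQ β _ fun z => (hP' (hβ z)).2⟩
  choose nextP hPR hPc hPE using hstep
  let P : ∀ n, OpenSubgroup (U n) := fun n => Nat.rec ⊤ (fun n P => nextP n P) n
  have hPchar : ∀ n, ∀ α : U n ≃ₜ* U n, ∀ g ∈ P n, α g ∈ P n := by
    rintro (_ | n)
    · exact fun _ _ _ => trivial
    · exact hPc n (P n)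
  let A : ℕ → Subgroup (Comm G) := fun n => (autCongr (P n)).map (rho (U n))
  let B : ℕ → Subgroup (Comm G) := fun n => autImage (U n)
  have hsep : ∀ m n, m < n → (rho _ (h m))⁻¹ * rho _ (h n) ∉ ⨆ n, A n := fun m n hmn => by
    refine inv_mul_notMem_iSup (A := A) (B := B) (h := fun n => rho _ (h n))
      (fun n => Subgroup.map_le_range _ _) (monotone_nat_of_le_succ fun n => ?_)
      (fun n => autImage_le_normalizer (hPchar n)) (fun n => ?_) (fun n => ⟨h n, rfl⟩)
      (fun n => ?_) hmn
    · rintro _ ⟨β, rfl⟩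
      exact ⟨_, rho_restrictAut (hUle n) β (hUst n β)⟩
    · rintro c ⟨⟨a, ha, e⟩, β, rfl⟩
      rw [← rho_restrictAut (hUle n) β (hUst n β)] at e
      exact ⟨β, hPE n (P n) β (hx.rho_injective _ e ▸ ha), rfl⟩
    · rintro _ ⟨β, rfl⟩ _ ⟨a, ha, rfl⟩ e
      rw [← rho_restrictAut (hUle n) β (hUst n β), ← map_mul] at e
      -- With `b` the restriction of `β`, `h n = b a` gives `(h n z)⁻¹ b z = b ((a z)⁻¹ z)`, which
      -- lies in the characteristic subgroup `P (n + 1)`.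
      refine hR n β fun z => hPR n (P n) ?_
      rw [hx.rho_injective _ e, aut_mul_apply, ← map_inv, ← map_mul]
      refine hPc n (P n) _ _ ?_
      have := inv_mem (ha z)
      rwa [mul_inv_rev, inv_inv] at this
  -- Every `O` contains some `U (n+1)`, and automorphisms of `O` close enough to the identity
  -- restrict into `A (n+1)`.
  have hM : (⨆ n, A n) ∈ autOpenSubgroups G := by
    intro O
    obtain ⟨n, hn⟩ := hW O
    have h1 := map_autCongr_le ((hUW n).trans hn) (P (n + 1))
    refine isOpen_of_autCongr_le (S := (⨆ n, A n).comap (rho O))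
      (comapOpen O (mapOpen (U (n + 1)) (P (n + 1)))) ?_
    rw [← Subgroup.map_le_iff_le_comap]
    exact h1.trans (le_iSup A (n + 1))
  obtain ⟨T, -, hT⟩ := hK.elim_nhds_subcover (fun c => {x | c⁻¹ * x ∈ ⨆ n, A n})
    fun c _ => (isOpen_leftCoset hM c).mem_nhds (by
      rw [Set.mem_ofPred_eq, inv_mul_cancel]
      exact one_mem _)
  -- Finitely many cosets of `⨆ n, A n` cover `K`, so two of the `h n` share one.
  have hcov : ∀ n, ∃ c : T, (c : Comm G)⁻¹ * rho _ (h n) ∈ ⨆ n, A n := fun n => by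
    obtain ⟨c, hc, hcn⟩ := Set.mem_iUnion₂.1 (hT (hHK (hhH n)))
    exact ⟨⟨c, hc⟩, hcn⟩
  choose c hc using hcov
  obtain ⟨m, n, hmn, e⟩ := Finite.exists_ne_map_eq_of_infinite c
  have key : ∀ m n, c m = c n → (rho _ (h m))⁻¹ * rho _ (h n) ∈ ⨆ n, A n := fun m n e => by
    have := mul_mem (inv_mem (hc m)) (e ▸ hc n)
    rwa [mul_inv_rev, inv_inv, mul_assoc, mul_inv_cancel_left] at this
  rcases lt_or_gt_of_ne hmn with h' | h'
  · exact hsep m n h' (key m n e)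
  · exact hsep n m h' (key n m e.symm)

end NotLocallyCompact

end AutTop

/-- A free pro-`p` group of finite rank `r > 1` is `Aut₁` but not `Aut₂`, and its commensurator
with the Aut-topology is not locally compact. -/
theorem mainTheorem11 (p : ℕ) [Fact p.Prime] (r : ℕ) (hr : 1 < r)
    (G : Type*) [Group G] [TopologicalSpace G] [IsTopologicalGroup G]
    (hG : AutTop.IsFreeProP p r G) :
    AutTop.IsAutOne G ∧ ¬ AutTop.IsAutTwo G ∧ ¬ LocallyCompactSpace (AutTop.Comm G) := by
  have := hG.1.compact
  have := hG.1.totallyDisconnected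
  have : Nontrivial (Fin r) := Fin.nontrivial_iff_two_le.2 hr
  obtain ⟨x, hx⟩ := AutTop.exists_isFreeBasis hG
  exact ⟨hx.isAutOne, hx.not_isAutTwo, hx.not_locallyCompactSpace⟩
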